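/- Let $n,p,q\ge 1$, $m_i,d_j\ge1$, and consider $$\min\ \sum_{i=1}^p f_i(x_i)+\sum_{j=1}^q g_j(y_j)\quad\text{s.t.}\quad \sum_i A_ix_i+\sum_j B_jy_j=c,\ x_i\in\mathcal X_i,\ y_j\in\mathcal Y_j,$$ where $f_i:\mathbb R^{m_i}\to\mathbb R$, $g_j:\mathbb R^{d_j}\to\mathbb R$ are convex, $A_i\in\mathbb R^{n\times m_i}$, $B_j\in\mathbb R^{n\times d_j}$ have full column rank, $c\in\mathbb R^n$, $\mathcal X_i,\mathcal Y_j$ are polyhedra, the graph of every subdifferential $\partial f_i,\partial g_j$ is a finite union of polyhedra, and the problem has an optimal solution. Write $w=(x,y,\lambda)$, $h(w)=\sum_i f_i(x_i)+\sum_j g_j(y_j)$, $r(x,y)=\sum_iA_ix_i+\sum_jB_jy_j-c$, $\mathcal M=\prod_i\mathcal X_i\times\prod_j\mathcal Y_j\times\mathbb R^n$, $\mathcal J(w)=\big((-A_i^{\sf T}\lambda)_i,(-B_j^{\sf T}\lambda)_j,r(x,y)\big)$, and $$\mathcal M^*=\{\hat w\in\mathcal M:\ h(w)-h(\hat w)+\langle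 w-\hat w,\mathcal J(w)\rangle\ge0\ \ \forall w\in\mathcal M\}.$$ Parameters: $\beta>0$, $\sigma_1>p-1$, $\sigma_2>q-1$, and $(\tau,s)\in\mathcal D=\{\tau<1,\ s<1,\ \tau+s>0\}$. With $\mathcal L_\beta(x,y,\lambda)=h-\langle\lambda,r(x,y)\rangle+\frac\beta2\|r(x,y)\|^2$, GS-ADMM generates $w^k=(x^k,y^k,\lambda^k)$ from an arbitrary $w^0$ by $$x_i^{k+1}\in\arg\min_{x_i\in\mathcal X_i}\mathcal L_\beta(x_1^k,\dots,x_i,\dots,x_p^k,y^k,\lambda^k)+\tfrac{\sigma_1\beta}2\|A_i(x_i-x_i^k)\|^2\ (1\le i\le p),\qquad \lambda^{k+1/2}=\lambda^k-\tau\beta\,r(x^{k+1},y^k),$$ $$y_j^{k+1}\in\arg\min_{y_j\in\mathcal Y_j}\mathcal L_\beta(x^{k+1},y_1^k,\dots,y_j,\dots,y_q^k,\lambda^{k+1/2})+\tfrac{\sigma_2\beta}2\|B_j(y_j-y_j^k)\|^2\ (1\le j\le q),\qquad \lambda^{k+1}=\lambda^{k+1/2}-s\beta\,r(x^{k+1},y^{k+1}).$$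 Matrices: $\mathcal B=[B_1,\dots,B_q]$; $H_{\mathbf x}$ has diagonal blocks $\beta\sigma_1A_i^{\sf T}A_i$ and off-diagonal blocks $-\beta A_i^{\sf T}A_l$; $$Q=\begin{bmatrix}H_{\mathbf x}&0&0\\0&(\sigma_2+1)\beta\,\mathrm{Diag}(B_j^{\sf T}B_j)&-\tau\mathcal B^{\sf T}\\0&-\mathcal B&\frac1\beta I\end{bmatrix},\quad M=\begin{bmatrix}I&0&0\\0&I&0\\0&-s\beta\mathcal B&(\tau+s)I\end{bmatrix},\quad G=Q+Q^{\sf T}-M^{\sf T}Q,\quad H=QM^{-1}.$$ Let $\|v\|_H^2=v^{\sf T}Hv$, $\mathrm{dist}_H^2(w,S)=\inf_{v\in S}\|w-v\|_H^2$, $\mathrm{dist}=\mathrm{dist}_I$. Constants: $\mu_i=\lambda_{\max}(A_i^{\sf T}A_i)$, $\nu_j=\lambda_{\max}(B_j^{\sf T}B_j)$, and $\delta=\max_{i,j}\{\theta_i,\vartheta_j,\eta\}$ with $$\theta_i=4p(1-\sigma_1)^2\beta^2\sum_l\mu_l+4\beta^2\mu_i,\qquad \eta=4(\tau+s-1)^2\sum_l\mu_l+3(s-1)^2\sum_l\nu_l+\tfrac2{\beta^2},$$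 $$\vartheta_j=4q(s\beta)^2\sum_l\mu_l+3q(s\beta)^2\sum_l\nu_l+3(\sigma_2+1)^2\beta^2\nu_j+2q .$$ For $w\in\mathcal M$ let $e_{\mathcal M}(w,1)$ be the set of vectors with blocks $x_i-\mathrm{P}_{\mathcal X_i}[x_i-(\xi_i-A_i^{\sf T}\lambda)]$, $y_j-\mathrm{P}_{\mathcal Y_j}[y_j-(\omega_j-B_j^{\sf T}\lambda)]$, $r(x,y)$, where $\xi_i\in\partial f_i(x_i)$, $\omega_j\in\partial g_j(y_j)$ and $\mathrm P$ is Euclidean projection. Then $\mathcal M^*\neq\emptyset$, and for every $R>0$ there is a constant $\zeta>0$, depending only on the problem data and $R$, such that (i) $\mathrm{dist}(w,\mathcal M^*)\le\zeta\,\mathrm{dist}(0,e_{\mathcal M}(w,1))$ for all $w\in\mathcal M$ with $\mathrm{dist}(w,\mathcal M^*)\le R$; (ii) for all parameters $\beta,\sigma_1,\sigma_2,\tau,s$ as above, the number $$\epsilon=\frac{\lambda_{\min}(G)}{\zeta^2\,\max_{i,j}\{\delta\mu_i,\delta\nu_j,\delta\}\,\lambda_{\max}(H)}$$ is positive, and every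 sequence $\{w^k\}$ generated by GS-ADMM with $\mathrm{dist}_H^2(w^0,\mathcal M^*)\le\lambda_{\min}(H)R^2$ satisfies $$\mathrm{dist}_H^2(w^{k+1},\mathcal M^*)\le\frac1{1+\epsilon}\,\mathrm{dist}_H^2(w^k,\mathcal M^*)\qquad\text{for all }k\ge0 .$$ (Since $H$ is positive definite, every GS-ADMM sequence is covered by a suitable $R$.) -/

import Mathlib

open scoped Matrix

namespace GSADMM

noncomputable section

/-! ## Polyhedra, subdifferentials, eigenvalues, weighted distances -/

/-- A polyhedron: the solution set of a finite system of non-strict linear inequalities. -/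
def IsPolyhedron {E : Type*} [AddCommGroup E] [Module ℝ E] (S : Set E) : Prop :=
  ∃ (N : ℕ) (φ : Fin N → E →ₗ[ℝ] ℝ) (b : Fin N → ℝ), S = {x | ∀ k, φ k x ≤ b k}

/-- A piecewise linear multifunction: its graph is a union of finitely many polyhedra. -/
def IsPiecewiseLinear {E F : Type*} [AddCommGroup E] [Module ℝ E] [AddCommGroup F] [Module ℝ F]
    (Φ : E → Set F) : Prop :=
  ∃ (N : ℕ) (S : Fin N → Set (E × F)),
    (∀ k, IsPolyhedron (S k)) ∧ {z : E × F | z.2 ∈ Φ z.1} = ⋃ k, S k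

/-- The subdifferential of `f : ℝᵐ → ℝ` at `x`. -/
def subdiff {ι : Type*} [Fintype ι] (f : (ι → ℝ) → ℝ) (x : ι → ℝ) : Set (ι → ℝ) :=
  {η | ∀ v, f x + η ⬝ᵥ (v - x) ≤ f v}

/-- The square of the Euclidean norm. -/
def sqNorm {ι : Type*} [Fintype ι] (v : ι → ℝ) : ℝ := v ⬝ᵥ v

/-- `‖v‖_H² = vᵀ H v`. -/
def sqNormW {ι : Type*} [Fintype ι] (H : Matrix ι ι ℝ) (v : ι → ℝ) : ℝ := v ⬝ᵥ (H *ᵥ v)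

/-- `dist_H²(w, S)`; the squared Euclidean distance is the case `H = 1`. -/
def distSq {ι : Type*} [Fintype ι] (H : Matrix ι ι ℝ) (w : ι → ℝ) (S : Set (ι → ℝ)) : ℝ :=
  sInf ((fun v => sqNormW H (w - v)) '' S)

/-- The largest (real) eigenvalue. -/
def lamMax {ι : Type*} [Fintype ι] [DecidableEq ι] (H : Matrix ι ι ℝ) : ℝ := sSup (spectrum ℝ H)

/-- The smallest (real) eigenvalue. -/
def lamMin {ι : Type*} [Fintype ι] [DecidableEq ι] (H : Matrix ι ι ℝ) : ℝ := sInf (spectrum ℝ H)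

/-- `z` is the Euclidean projection of `x` on `S`. -/
def IsProj {ι : Type*} [Fintype ι] (S : Set (ι → ℝ)) (x z : ι → ℝ) : Prop :=
  z ∈ S ∧ IsMinOn (fun v => sqNorm (v - x)) S z

/-! ## The problem -/

/-- Data of `min ∑ fᵢ(xᵢ) + ∑ gⱼ(yⱼ)` subject to `∑ Aᵢ xᵢ + ∑ Bⱼ yⱼ = c`, `xᵢ ∈ Xᵢ`, `yⱼ ∈ Yⱼ`,
where `xᵢ ∈ ℝ^(m i)` and `yⱼ ∈ ℝ^(d j)`. -/
structure Problem (n : ℕ) {p q : ℕ} (m : Fin p → ℕ) (d : Fin q → ℕ) where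
  /-- the matrices `Aᵢ` -/
  A : ∀ i, Matrix (Fin n) (Fin (m i)) ℝ
  /-- the matrices `Bⱼ` -/
  B : ∀ j, Matrix (Fin n) (Fin (d j)) ℝ
  /-- the right-hand side -/
  c : Fin n → ℝ
  /-- the functions `fᵢ` -/
  f : ∀ i, (Fin (m i) → ℝ) → ℝ
  /-- the functions `gⱼ` -/
  g : ∀ j, (Fin (d j) → ℝ) → ℝ
  /-- the constraint sets `Xᵢ` -/
  X : ∀ i, Set (Fin (m i) → ℝ)
  /-- the constraint sets `Yⱼ` -/
  Y : ∀ j, Set (Fin (d j) → ℝ)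

/-- The parameters of the algorithm. -/
structure Params where
  /-- penalty parameter -/
  β : ℝ
  /-- proximal parameter of the `x`-blocks -/
  σ₁ : ℝ
  /-- proximal parameter of the `y`-blocks -/
  σ₂ : ℝ
  /-- first dual stepsize -/
  τ : ℝ
  /-- second dual stepsize -/
  s : ℝ

/-- Admissible parameters: `β > 0`, `σ₁ > p - 1`, `σ₂ > q - 1`, and `(τ, s)` in the triangle
`τ < 1`, `s < 1`, `τ + s > 0`. -/
def Params.Admissible (a : Params) (p q : ℕ) : Prop :=
  0 < a.β ∧ (p : ℝ) - 1 < a.σ₁ ∧ (q : ℝ) - 1 < a.σ₂ ∧ a.τ < 1 ∧ a.s < 1 ∧ 0 < a.τ + a.s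

/-- Coordinates of a family of blocks. -/
abbrev BIdx {p : ℕ} (m : Fin p → ℕ) : Type := Σ i, Fin (m i)

/-- Coordinates of `w = (x, y, lam)`. -/
abbrev WIdx (n : ℕ) {p q : ℕ} (m : Fin p → ℕ) (d : Fin q → ℕ) : Type :=
  BIdx m ⊕ (BIdx d ⊕ Fin n)

/-- The space of the vectors `w = (x, y, lam)`. -/
abbrev WVec (n : ℕ) {p q : ℕ} (m : Fin p → ℕ) (d : Fin q → ℕ) : Type := WIdx n m d → ℝ

section parts

variable {n p q : ℕ} {m : Fin p → ℕ} {d : Fin q → ℕ}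

/-- The blocks `xᵢ` of `w`. -/
def xPart (w : WVec n m d) : ∀ i, Fin (m i) → ℝ := fun i r => w (Sum.inl ⟨i, r⟩)

/-- The blocks `yⱼ` of `w`. -/
def yPart (w : WVec n m d) : ∀ j, Fin (d j) → ℝ := fun j r => w (Sum.inr (Sum.inl ⟨j, r⟩))

/-- The multiplier block of `w`. -/
def lamPart (w : WVec n m d) : Fin n → ℝ := fun r => w (Sum.inr (Sum.inr r))

end parts

namespace Problem

variable {n p q : ℕ} {m : Fin p → ℕ} {d : Fin q → ℕ} (P : Problem n m d)

/-- The objective `h(u) = ∑ fᵢ(xᵢ) + ∑ gⱼ(yⱼ)`. -/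
def obj (x : ∀ i, Fin (m i) → ℝ) (y : ∀ j, Fin (d j) → ℝ) : ℝ :=
  ∑ i, P.f i (x i) + ∑ j, P.g j (y j)

/-- `𝒜 x + ℬ y - c`. -/
def resid (x : ∀ i, Fin (m i) → ℝ) (y : ∀ j, Fin (d j) → ℝ) : Fin n → ℝ :=
  ∑ i, P.A i *ᵥ x i + ∑ j, P.B j *ᵥ y j - P.c

/-- `(x, y)` is feasible. -/
def Feasible (x : ∀ i, Fin (m i) → ℝ) (y : ∀ j, Fin (d j) → ℝ) : Prop :=
  (∀ i, x i ∈ P.X i) ∧ (∀ j, y j ∈ P.Y j) ∧ P.resid x y = 0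

/-- `(x, y)` is an optimal solution of the problem. -/
def IsSolution (x : ∀ i, Fin (m i) → ℝ) (y : ∀ j, Fin (d j) → ℝ) : Prop :=
  P.Feasible x y ∧ ∀ x' y', P.Feasible x' y' → P.obj x y ≤ P.obj x' y'

/-- The augmented Lagrangian. -/
def augLag (β : ℝ) (x : ∀ i, Fin (m i) → ℝ) (y : ∀ j, Fin (d j) → ℝ) (lam : Fin n → ℝ) : ℝ :=
  P.obj x y - lam ⬝ᵥ P.resid x y + β / 2 * sqNorm (P.resid x y)

/-- `ℳ = X × Y × ℝⁿ`. -/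
def feasW : Set (WVec n m d) :=
  {w | (∀ i, xPart w i ∈ P.X i) ∧ ∀ j, yPart w j ∈ P.Y j}

/-- `𝒥(w) = (-𝒜ᵀ lam, -ℬᵀ lam, 𝒜 x + ℬ y - c)`. -/
def J (w : WVec n m d) : WVec n m d :=
  Sum.elim (fun a => -((P.A a.1)ᵀ *ᵥ lamPart w) a.2)
    (Sum.elim (fun b => -((P.B b.1)ᵀ *ᵥ lamPart w) b.2) (P.resid (xPart w) (yPart w)))

/-- The solution set `ℳ*` of the variational inequality. -/
def solSet : Set (WVec n m d) :=
  {v ∈ P.feasW | ∀ w ∈ P.feasW,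
    0 ≤ P.obj (xPart w) (yPart w) - P.obj (xPart v) (yPart v) + (w - v) ⬝ᵥ P.J w}

/-- The set-valued residual `e_ℳ(w, γ)`, with blocks
`xᵢ - Proj_{Xᵢ}[xᵢ - γ (∂fᵢ(xᵢ) - Aᵢᵀ lam)]`, `yⱼ - Proj_{Yⱼ}[yⱼ - γ (∂gⱼ(yⱼ) - Bⱼᵀ lam)]` and
`γ (𝒜 x + ℬ y - c)`. -/
def errMap (w : WVec n m d) (γ : ℝ) : Set (WVec n m d) :=
  {e | (∀ i, ∃ η ∈ subdiff (P.f i) (xPart w i), ∃ z,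
          IsProj (P.X i) (xPart w i - γ • (η - (P.A i)ᵀ *ᵥ lamPart w)) z ∧
          xPart e i = xPart w i - z) ∧
       (∀ j, ∃ ν ∈ subdiff (P.g j) (yPart w j), ∃ z,
          IsProj (P.Y j) (yPart w j - γ • (ν - (P.B j)ᵀ *ᵥ lamPart w)) z ∧
          yPart e j = yPart w j - z) ∧
       lamPart e = γ • P.resid (xPart w) (yPart w)}

/-! ## The algorithm -/

/-- `lam^{k+1/2} = lam^k - τ β (𝒜 x^{k+1} + ℬ y^k - c)`, from `w = w^k` and `w' = w^{k+1}`. -/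
def lamHalf (a : Params) (w w' : WVec n m d) : Fin n → ℝ :=
  lamPart w - (a.τ * a.β) • P.resid (xPart w') (yPart w)

/-- `w'` arises from `w` by one iteration of GS-ADMM. -/
def IsStep (a : Params) (w w' : WVec n m d) : Prop :=
  (∀ i, xPart w' i ∈ P.X i ∧
    IsMinOn (fun z : Fin (m i) → ℝ =>
      P.augLag a.β (Function.update (xPart w) i z) (yPart w) (lamPart w)
        + a.σ₁ * a.β / 2 * sqNorm (P.A i *ᵥ (z - xPart w i))) (P.X i) (xPart w' i)) ∧
  (∀ j, yPart w' j ∈ P.Y j ∧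
    IsMinOn (fun z : Fin (d j) → ℝ =>
      P.augLag a.β (xPart w') (Function.update (yPart w) j z) (P.lamHalf a w w')
        + a.σ₂ * a.β / 2 * sqNorm (P.B j *ᵥ (z - yPart w j))) (P.Y j) (yPart w' j)) ∧
  lamPart w' = P.lamHalf a w w' - (a.s * a.β) • P.resid (xPart w') (yPart w')

/-- The sequence `w⁰, w¹, …` is generated by GS-ADMM, from an arbitrary starting point. -/
def IsGSADMM (a : Params) (w : ℕ → WVec n m d) : Prop := ∀ k, P.IsStep a (w k) (w (k + 1))

/-! ## The matrices of the analysis -/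

/-- `ℬ = [B₁, …, B_q]`. -/
def calB : Matrix (Fin n) (BIdx d) ℝ := Matrix.of fun r b => P.B b.1 r b.2

/-- `H_x`: the diagonal blocks are `β σ₁ Aᵢᵀ Aᵢ`, the others `-β Aᵢᵀ Aₗ`. -/
def matHx (a : Params) : Matrix (BIdx m) (BIdx m) ℝ :=
  Matrix.of fun u v =>
    a.β * ((if u.1 = v.1 then a.σ₁ else -1) * ((P.A u.1)ᵀ * P.A v.1) u.2 v.2)

/-- The matrix `Q`. -/
def matQ (a : Params) : Matrix (WIdx n m d) (WIdx n m d) ℝ :=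
  Matrix.fromBlocks (P.matHx a) 0 0
    (Matrix.fromBlocks
      (Matrix.blockDiagonal' fun j => ((a.σ₂ + 1) * a.β) • ((P.B j)ᵀ * P.B j))
      (-a.τ • P.calBᵀ)
      (-P.calB)
      ((1 / a.β) • (1 : Matrix (Fin n) (Fin n) ℝ)))

/-- The matrix `M`. -/
def matM (a : Params) : Matrix (WIdx n m d) (WIdx n m d) ℝ :=
  Matrix.fromBlocks 1 0 0
    (Matrix.fromBlocks 1 0 (-(a.s * a.β) • P.calB)
      ((a.τ + a.s) • (1 : Matrix (Fin n) (Fin n) ℝ)))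

/-- `G = Q + Qᵀ - Mᵀ Q`. -/
def matG (a : Params) : Matrix (WIdx n m d) (WIdx n m d) ℝ :=
  P.matQ a + (P.matQ a)ᵀ - (P.matM a)ᵀ * P.matQ a

/-- `H = Q M⁻¹`. -/
def matH (a : Params) : Matrix (WIdx n m d) (WIdx n m d) ℝ := P.matQ a * (P.matM a)⁻¹

/-! ## The constants -/

/-- `μᵢ = λ_max(Aᵢᵀ Aᵢ)`. -/
def mu (i : Fin p) : ℝ := lamMax ((P.A i)ᵀ * P.A i)

/-- `νⱼ = λ_max(Bⱼᵀ Bⱼ)`. -/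
def nu (j : Fin q) : ℝ := lamMax ((P.B j)ᵀ * P.B j)

/-- `θᵢ`. -/
def thetaBar (a : Params) (i : Fin p) : ℝ :=
  4 * p * (1 - a.σ₁) ^ 2 * a.β ^ 2 * ∑ l, P.mu l + 4 * a.β ^ 2 * P.mu i

/-- `ϑⱼ`. -/
def varthetaBar (a : Params) (j : Fin q) : ℝ :=
  4 * q * (a.s * a.β) ^ 2 * ∑ l, P.mu l + 3 * q * (a.s * a.β) ^ 2 * ∑ l, P.nu l
    + 3 * (a.σ₂ + 1) ^ 2 * a.β ^ 2 * P.nu j + 2 * q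

/-- `η`. -/
def etaBar (a : Params) : ℝ :=
  4 * (a.τ + a.s - 1) ^ 2 * ∑ l, P.mu l + 3 * (a.s - 1) ^ 2 * ∑ l, P.nu l + 2 / a.β ^ 2

/-- `δ = max {θᵢ, ϑⱼ, η}` (the suprema are maxima over finite nonempty index sets). -/
def delta (a : Params) : ℝ :=
  max (⨆ i, P.thetaBar a i) (max (⨆ j, P.varthetaBar a j) (P.etaBar a))

/-- `max {δ μᵢ, δ νⱼ, δ}`. -/
def deltaMax (a : Params) : ℝ :=
  max (⨆ i, P.delta a * P.mu i) (max (⨆ j, P.delta a * P.nu j) (P.delta a))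

/-- `ε = λ_min(G) / (ζ² max {δ μᵢ, δ νⱼ, δ} λ_max(H))`. -/
def eps (a : Params) (ζ : ℝ) : ℝ :=
  lamMin (P.matG a) / (ζ ^ 2 * P.deltaMax a * lamMax (P.matH a))

end Problem

end

end GSADMM

/-!
The existence of a solution of the variational inequality is the existence of Lagrange multipliers
for a convex problem with polyhedral constraints: a subgradient at the optimum that is normal to the
feasible polyhedron (`exists_subgradient`, by Hahn–Banach) is split by Farkas' lemma
(`farkas`, `polyhedron_normal`) into a multiplier of the equations and a normal vector of `ℳ`
(`Problem.solSet_nonempty`).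

The error bound rests on polyhedrality. The graph of the projection on a polyhedron is a finite
union of polyhedra (`isPL_isProj`), hence so is the graph of the residual map with the subgradients
kept as additional variables (`Problem.isPL_errGraph`). On each piece, Hoffman's bound (`hoffman`) compares
the distance to the slice `e = 0` with `‖e‖`, and a piece without such a slice stays away from
`e = 0` (`infeasible_gap`). Zeros of the residual map solve the variational inequality. Thus
`dist(w, ℳ*) ≤ C ‖e‖` for small `e`, and for large `e` the bound `dist(w, ℳ*) ≤ R` suffices
(`Problem.exists_error_bound`).

For the rate, one iteration is a prediction followed by a correction `w⁺ = w - M (w - w̃)`. The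
optimality conditions of the subproblems give `⟨w̃ - w*, Q (w - w̃)⟩ ≥ 0` for every solution `w*`
(`Problem.IsStep.predictor_inequality`). Since `Q = H M` and `G = Q + Qᵀ - Mᵀ Q`, this is
`‖w⁺ - w*‖_H² + ‖w - w̃‖_G² ≤ ‖w - w*‖_H²` (`Problem.IsStep.contraction`); `H` and `G` are positive
definite by completing squares (`Problem.quadratic_form_pos`). The same optimality conditions
exhibit an element of `e_ℳ(w⁺, 1)` of squared norm at most `(8 + 2p) p max {δ μᵢ, δ νⱼ, δ} ‖w - w̃‖²`
(`Problem.IsStep.exists_errMap_le`). Combined with the error bound, `‖w - w̃‖_G²` is at least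
`ε dist_H²(w⁺, ℳ*)`, which is the claim (`Problem.IsStep.distSq_le`). The factor `(8 + 2p) p` does
not depend on the parameters of the method, so it may be put into `ζ`.
-/

namespace GSADMM

/-! ### Finitely generated cones -/

/-- **Farkas' lemma** over an arbitrary real vector space: if every direction in which all `φ k` are
non-positive is one in which `y` is non-positive, then `y` is a conic combination of the `φ k`.
The proof is Bartl's induction on the number of functionals. -/
theorem farkas {E : Type*} [AddCommGroup E] [Module ℝ E] (N : ℕ) :
    ∀ (φ : Fin N → E →ₗ[ℝ] ℝ) (y : E →ₗ[ℝ] ℝ),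
      (∀ v, (∀ k, φ k v ≤ 0) → y v ≤ 0) →
      ∃ ρ : Fin N → ℝ, (∀ k, 0 ≤ ρ k) ∧ y = ∑ k, ρ k • φ k := by
  induction N with
  | zero =>
    intro φ y h
    refine ⟨fun _ => 0, fun _ => le_rfl, LinearMap.ext fun v => ?_⟩
    have h1 := h v (fun k => k.elim0)
    have h2 := h (-v) (fun k => k.elim0)
    simp only [map_neg] at h2
    simp
    linarith
  | succ N ih =>
    intro φ y h
    by_cases hy : ∀ v, (∀ k : Fin N, φ k.castSucc v ≤ 0) → y v ≤ 0
    · obtain ⟨ρ, hρ, he⟩ := ih (fun k => φ k.castSucc) y hy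
      refine ⟨Fin.snoc ρ 0, fun k => ?_, ?_⟩
      · refine Fin.lastCases ?_ (fun i => ?_) k
        · simp
        · simpa using hρ i
      · rw [Fin.sum_univ_castSucc]
        simpa using he
    · push Not at hy
      obtain ⟨v₀, hv₀, hyv₀⟩ := hy
      -- `v₀` violates the conclusion for the first `N` functionals, so the last is positive on it
      have hpos : 0 < φ (Fin.last N) v₀ := by
        by_contra hle
        push Not at hle
        have := h v₀ (fun k => Fin.lastCases hle hv₀ k)
        linarith
      set t := φ (Fin.last N) v₀ with ht
      obtain ⟨ρ, hρ, he⟩ := ih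
        (fun k => φ k.castSucc - (φ k.castSucc v₀ / t) • φ (Fin.last N))
        (y - (y v₀ / t) • φ (Fin.last N)) (by
          intro v hv
          have key : ∀ ψ : E →ₗ[ℝ] ℝ, (ψ - (ψ v₀ / t) • φ (Fin.last N)) v
              = ψ (v - (φ (Fin.last N) v / t) • v₀) := by
            intro ψ
            simp only [LinearMap.sub_apply, LinearMap.smul_apply, map_sub, map_smul, smul_eq_mul]
            ring
          rw [key]
          apply h
          intro k
          refine Fin.lastCases ?_ (fun i => ?_) k
          · simp only [map_sub, map_smul, smul_eq_mul, ← ht]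
            rw [div_mul_cancel₀ _ hpos.ne', sub_self]
          · rw [← key]
            exact hv i)
      refine ⟨Fin.snoc ρ (y v₀ / t - ∑ k, ρ k * (φ k.castSucc v₀ / t)), fun k => ?_, ?_⟩
      · refine Fin.lastCases ?_ (fun i => ?_) k
        · simp only [Fin.snoc_last]
          have h1 : 0 ≤ y v₀ / t := by positivity
          have h2 : ∑ k, ρ k * (φ k.castSucc v₀ / t) ≤ 0 :=
            Finset.sum_nonpos fun k _ =>
              mul_nonpos_of_nonneg_of_nonpos (hρ k) (div_nonpos_of_nonpos_of_nonneg (hv₀ k) hpos.le)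
          linarith
        · simpa using hρ i
      · rw [Fin.sum_univ_castSucc]
        simp only [Fin.snoc_castSucc, Fin.snoc_last]
        refine LinearMap.ext fun v => ?_
        have hv := LinearMap.congr_fun he v
        simp only [LinearMap.sub_apply, LinearMap.add_apply, LinearMap.sum_apply,
          LinearMap.smul_apply, smul_eq_mul, mul_sub, Finset.sum_sub_distrib, sub_mul,
          Finset.sum_mul, mul_assoc] at hv ⊢
        linarith

/-- **Farkas' lemma** for a family indexed by any finite type. -/
theorem farkas_fintype {E κ : Type*} [AddCommGroup E] [Module ℝ E] [Fintype κ]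
    (φ : κ → E →ₗ[ℝ] ℝ) (y : E →ₗ[ℝ] ℝ) (h : ∀ v, (∀ k, φ k v ≤ 0) → y v ≤ 0) :
    ∃ ρ : κ → ℝ, (∀ k, 0 ≤ ρ k) ∧ y = ∑ k, ρ k • φ k := by
  let e := Fintype.equivFin κ
  obtain ⟨ρ, hρ, he⟩ := farkas (Fintype.card κ) (fun k => φ (e.symm k)) y
    (fun v hv => h v fun k => by simpa using hv (e k))
  refine ⟨fun k => ρ (e k), fun k => hρ _, ?_⟩
  rw [he, ← e.symm.sum_comp]
  simp

/-- **Carathéodory's theorem for cones**: a conic combination can be rewritten with linearly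
independent generators, all among those that were used. A representation of minimal support
does. -/
theorem exists_conic_linearIndependent {V κ : Type*} [AddCommGroup V] [Module ℝ V] [Fintype κ]
    (φ : κ → V) (ρ : κ → ℝ) (hρ : ∀ k, 0 ≤ ρ k) :
    ∃ (J : Finset κ) (σ : κ → ℝ), (∀ k, 0 ≤ σ k) ∧ (∀ k ∈ J, ρ k ≠ 0) ∧ (∀ k ∉ J, σ k = 0) ∧
      LinearIndependent ℝ (fun k : J => φ k) ∧ ∑ k, σ k • φ k = ∑ k, ρ k • φ k := by
  classical
  induction hn : (Finset.univ.filter fun k => ρ k ≠ 0).card using Nat.strong_induction_on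
    generalizing ρ with
  | _ n ih =>
    set J := Finset.univ.filter fun k => ρ k ≠ 0 with hJ
    by_cases hli : LinearIndependent ℝ (fun k : J => φ k)
    · exact ⟨J, ρ, hρ, fun k hk => by simpa [hJ] using hk, fun k hk => by simpa [hJ] using hk,
        hli, rfl⟩
    · rw [Fintype.not_linearIndependent_iff] at hli
      obtain ⟨c, hc, k₀, hk₀⟩ := hli
      -- a linear dependence with a positive coefficient, extended by zero
      obtain ⟨c', hc', hc0, k₁, hk₁⟩ : ∃ c' : κ → ℝ, ∑ k, c' k • φ k = 0 ∧
          (∀ k ∉ J, c' k = 0) ∧ ∃ k, 0 < c' k := by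
        have aux : ∀ b : J → ℝ, ∑ k, b k • φ k = 0 →
            ∑ k, (if h : k ∈ J then b ⟨k, h⟩ else 0) • φ k = 0 := by
          intro b hb
          rw [← Finset.sum_subset (Finset.subset_univ J) (fun x _ hx => by simp [hx]),
            ← Finset.sum_coe_sort, ← hb]
          exact Finset.sum_congr rfl fun x _ => by simp
        rcases lt_or_gt_of_ne hk₀ with h | h
        · refine ⟨_, aux (fun k => -c k) (by simpa using hc), fun k hk => by simp [hk], k₀, ?_⟩
          simpa using h
        · refine ⟨_, aux c hc, fun k hk => by simp [hk], k₀, ?_⟩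
          simpa using h
      let P := Finset.univ.filter fun k => 0 < c' k
      have hP : P.Nonempty := ⟨k₁, by simp [P, hk₁]⟩
      obtain ⟨k₂, hk₂, hmin⟩ := P.exists_min_image (fun k => ρ k / c' k) hP
      have hc₂ : 0 < c' k₂ := by simpa [P] using hk₂
      set t := ρ k₂ / c' k₂ with ht
      have htn : 0 ≤ t := div_nonneg (hρ _) hc₂.le
      have hρ' : ∀ k, 0 ≤ ρ k - t * c' k := by
        intro k
        by_cases hk : 0 < c' k
        · have := hmin k (by simp [P, hk])
          rw [le_div_iff₀ hk] at this
          linarith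
        · push Not at hk
          nlinarith [hρ k]
      have hsub : ∀ k, ρ k - t * c' k ≠ 0 → ρ k ≠ 0 := by
        intro k hk h0
        have : k ∉ J := by simp [hJ, h0]
        exact hk (by simp [h0, hc0 k this])
      have hk₂J : k₂ ∈ J := by
        by_contra h
        exact hc₂.ne' (hc0 _ h)
      have hcard : (Finset.univ.filter fun k => ρ k - t * c' k ≠ 0).card < n := by
        rw [← hn]
        apply Finset.card_lt_card
        refine ⟨fun k hk => ?_, fun hss => ?_⟩
        · simp only [Finset.mem_filter, Finset.mem_univ, true_and, hJ] at hk ⊢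
          exact hsub k hk
        · have := hss hk₂J
          simp only [Finset.mem_filter, Finset.mem_univ, true_and] at this
          apply this
          rw [ht, div_mul_cancel₀ _ hc₂.ne', sub_self]
      obtain ⟨J', σ, h1, h2, h3, h4, h5⟩ := ih _ hcard (fun k => ρ k - t * c' k) hρ' rfl
      refine ⟨J', σ, h1, fun k hk => hsub k (h2 k hk), h3, h4, ?_⟩
      rw [h5]
      simp only [sub_smul, Finset.sum_sub_distrib, mul_smul, ← Finset.smul_sum, hc', smul_zero,
        sub_zero]

/-! ### Normal cones of polyhedra -/

/-- The normal cone of a polyhedron at one of its points `z` is generated by the functionals of the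
constraints active at `z`. -/
theorem polyhedron_normal {E κ : Type*} [AddCommGroup E] [Module ℝ E] [Fintype κ]
    (φ : κ → E →ₗ[ℝ] ℝ) (b : κ → ℝ) (z : E) (hz : ∀ k, φ k z ≤ b k) (y : E →ₗ[ℝ] ℝ)
    (hy : ∀ x, (∀ k, φ k x ≤ b k) → y x ≤ y z) :
    ∃ ρ : κ → ℝ, (∀ k, 0 ≤ ρ k) ∧ (∀ k, ρ k ≠ 0 → φ k z = b k) ∧ y = ∑ k, ρ k • φ k := by
  classical
  let A := {k // φ k z = b k}
  obtain ⟨ρ, hρ, he⟩ := farkas_fintype (fun k : A => φ k) y (by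
    intro v hv
    -- a short step from `z` along `v` stays in the polyhedron
    have : ∃ t : ℝ, 0 < t ∧ ∀ k, φ k (z + t • v) ≤ b k := by
      have hk : ∀ k, ∀ᶠ t : ℝ in nhdsWithin 0 (Set.Ioi 0), φ k (z + t • v) ≤ b k := by
        intro k
        simp only [map_add, map_smul, smul_eq_mul]
        by_cases h : φ k z = b k
        · filter_upwards [self_mem_nhdsWithin] with t ht
          have := hv ⟨k, h⟩
          have ht' : (0 : ℝ) < t := ht
          simp only at this
          nlinarith
        · have hlt : φ k z < b k := lt_of_le_of_ne (hz k) h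
          have hc : Filter.Tendsto (fun t : ℝ => φ k z + t * φ k v) (nhds 0)
              (nhds (φ k z + 0 * φ k v)) := by
            apply Continuous.tendsto
            fun_prop
          rw [zero_mul, add_zero] at hc
          exact (hc.mono_left nhdsWithin_le_nhds).eventually_le_const hlt
      have hall := (Filter.eventually_all.2 hk).and self_mem_nhdsWithin
      obtain ⟨t, h1, h2⟩ := hall.exists
      exact ⟨t, h2, h1⟩
    obtain ⟨t, ht, hfeas⟩ := this
    have := hy _ hfeas
    simp only [map_add, map_smul, smul_eq_mul] at this
    by_contra hpos
    push Not at hpos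
    nlinarith [mul_pos ht hpos])
  refine ⟨fun k => if h : φ k z = b k then ρ ⟨k, h⟩ else 0, fun k => ?_, fun k hk => ?_, ?_⟩
  · dsimp only
    split_ifs with h
    · exact hρ _
    · exact le_rfl
  · by_contra h
    simp [h] at hk
  · rw [he]
    symm
    rw [← Finset.sum_subset (Finset.subset_univ (Finset.univ.filter fun k => φ k z = b k))
      (fun x _ hx => by
        simp only [Finset.mem_filter, Finset.mem_univ, true_and] at hx
        simp [hx])]
    rw [Finset.sum_subtype (p := fun k => φ k z = b k) _ (by simp)]
    exact Finset.sum_congr rfl fun x _ => by simp [x.2]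

/-! ### Euclidean projections -/

section projection

variable {ι : Type*} [Fintype ι]

theorem sqNorm_nonneg (v : ι → ℝ) : 0 ≤ sqNorm v :=
  Finset.sum_nonneg fun i _ => mul_self_nonneg (v i)

theorem sqNorm_neg (v : ι → ℝ) : sqNorm (-v) = sqNorm v := by
  simp [sqNorm]

theorem sqNorm_smul (t : ℝ) (v : ι → ℝ) : sqNorm (t • v) = t ^ 2 * sqNorm v := by
  simp only [sqNorm, smul_dotProduct, dotProduct_smul, smul_eq_mul]
  ring

theorem sqNorm_add (u v : ι → ℝ) : sqNorm (u + v) = sqNorm u + 2 * (u ⬝ᵥ v) + sqNorm v := by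
  simp only [sqNorm, add_dotProduct, dotProduct_add, dotProduct_comm v u]
  ring

theorem sqNorm_sub (u v : ι → ℝ) : sqNorm (u - v) = sqNorm u - 2 * (u ⬝ᵥ v) + sqNorm v := by
  simp only [sqNorm, sub_dotProduct, dotProduct_sub, dotProduct_comm v u]
  ring

theorem sqNorm_add_le (u v : ι → ℝ) : sqNorm (u + v) ≤ 2 * sqNorm u + 2 * sqNorm v := by
  have h := sqNorm_nonneg (u - v)
  rw [sqNorm_sub] at h
  rw [sqNorm_add]
  linarith

theorem sqNorm_eq_zero {v : ι → ℝ} : sqNorm v = 0 ↔ v = 0 := dotProduct_self_eq_zero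

/-- The Cauchy–Schwarz inequality. -/
theorem dotProduct_sq_le (u v : ι → ℝ) : (u ⬝ᵥ v) ^ 2 ≤ sqNorm u * sqNorm v := by
  have h := Finset.sum_mul_sq_le_sq_mul_sq Finset.univ u v
  simpa [dotProduct, sqNorm, sq] using h

theorem sqNorm_sum_le {κ : Type*} [Fintype κ] (v : κ → ι → ℝ) :
    sqNorm (∑ k, v k) ≤ Fintype.card κ * ∑ k, sqNorm (v k) := by
  simp only [sqNorm, dotProduct, Finset.sum_apply]
  rw [Finset.sum_comm, Finset.mul_sum]
  refine Finset.sum_le_sum fun i _ => ?_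
  have h := sq_sum_le_card_mul_sum_sq (s := Finset.univ) (f := fun k => v k i)
  simpa [sq] using h

theorem norm_sq_le_sqNorm (v : ι → ℝ) : ‖v‖ ^ 2 ≤ sqNorm v := by
  rw [← Real.le_sqrt (norm_nonneg _) (sqNorm_nonneg v)]
  rw [pi_norm_le_iff_of_nonneg (Real.sqrt_nonneg _)]
  intro i
  apply Real.le_sqrt_of_sq_le
  rw [Real.norm_eq_abs, sq_abs, sq]
  exact Finset.single_le_sum (f := fun i => v i * v i) (fun i _ => mul_self_nonneg _)
    (Finset.mem_univ i)

theorem sqNorm_le_card_mul_norm_sq (v : ι → ℝ) : sqNorm v ≤ Fintype.card ι * ‖v‖ ^ 2 := by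
  rw [← nsmul_eq_mul, ← Finset.card_univ]
  apply Finset.sum_le_card_nsmul
  intro i _
  have := norm_le_pi_norm v i
  rw [Real.norm_eq_abs] at this
  rw [← abs_mul_abs_self]
  nlinarith [abs_nonneg (v i)]

theorem exists_projection {S : Set (ι → ℝ)} (hc : IsClosed S) (hS : Convex ℝ S)
    (hne : S.Nonempty) (w : ι → ℝ) :
    ∃ z ∈ S, ∀ x ∈ S, (w - z) ⬝ᵥ (x - z) ≤ 0 := by
  let L := (WithLp.linearEquiv 2 ℝ (ι → ℝ))
  let K : Set (EuclideanSpace ℝ ι) := {x | WithLp.ofLp x ∈ S}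
  have hKc : IsClosed K := hc.preimage (PiLp.continuous_ofLp 2 _)
  have hK : Convex ℝ K := hS.linear_preimage L.toLinearMap
  have hKn : K.Nonempty := ⟨WithLp.toLp 2 hne.some, hne.some_mem⟩
  obtain ⟨z, hz, hmin⟩ := exists_norm_eq_iInf_of_complete_convex hKn hKc.isComplete hK
    (WithLp.toLp 2 w)
  rw [norm_eq_iInf_iff_real_inner_le_zero hK hz] at hmin
  refine ⟨WithLp.ofLp z, hz, fun x hx => ?_⟩
  have h := hmin (WithLp.toLp 2 x) hx
  rw [EuclideanSpace.inner_eq_star_dotProduct] at h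
  simpa [dotProduct_comm] using h

/-- The variational characterisation of the projection on a convex set. -/
theorem isProj_iff {S : Set (ι → ℝ)} (hS : Convex ℝ S) (w z : ι → ℝ) :
    IsProj S w z ↔ z ∈ S ∧ ∀ x ∈ S, (w - z) ⬝ᵥ (x - z) ≤ 0 := by
  constructor
  · rintro ⟨hz, hmin⟩
    refine ⟨hz, fun x hx => ?_⟩
    have key : ∀ t : ℝ, 0 < t → t ≤ 1 → 2 * ((w - z) ⬝ᵥ (x - z)) ≤ t * sqNorm (x - z) := by
      intro t h0 h1
      have hmem : z + t • (x - z) ∈ S := hS.add_smul_sub_mem hz hx ⟨h0.le, h1⟩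
      have h : sqNorm (z - w) ≤ sqNorm (z + t • (x - z) - w) := hmin hmem
      have e : z + t • (x - z) - w = t • (x - z) - (w - z) := by abel
      rw [← neg_sub w z, sqNorm_neg, e, sqNorm_sub (t • (x - z)), sqNorm_smul,
        smul_dotProduct, smul_eq_mul, dotProduct_comm (x - z)] at h
      have : t * (2 * ((w - z) ⬝ᵥ (x - z))) ≤ t * (t * sqNorm (x - z)) := by linarith
      exact le_of_mul_le_mul_left this h0
    by_contra hpos
    push Not at hpos
    have hN := sqNorm_nonneg (x - z)
    have hN' : 0 < sqNorm (x - z) + 1 := by linarith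
    set D := (w - z) ⬝ᵥ (x - z)
    -- the step length `D / (‖x - z‖² + 1)`, or `1` if that is smaller, contradicts minimality
    rcases le_total (D / (sqNorm (x - z) + 1)) 1 with h1 | h1
    · have h := key _ (div_pos hpos hN') h1
      rw [div_mul_eq_mul_div, le_div_iff₀ hN'] at h
      nlinarith
    · have h := key 1 one_pos le_rfl
      rw [le_div_iff₀ hN'] at h1
      linarith
  · rintro ⟨hz, h⟩
    refine ⟨hz, fun x hx => ?_⟩
    have := h x hx
    have e : x - w = (x - z) - (w - z) := by abel
    change sqNorm (z - w) ≤ sqNorm (x - w)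
    rw [← neg_sub w z, sqNorm_neg, e, sqNorm_sub (x - z), dotProduct_comm (x - z)]
    linarith [sqNorm_nonneg (x - z)]

theorem sqNorm_projection_sub_le {S : Set (ι → ℝ)} {u v y z : ι → ℝ} (hy : y ∈ S) (hz : z ∈ S)
    (hu : ∀ x ∈ S, (u - y) ⬝ᵥ (x - y) ≤ 0) (hv : ∀ x ∈ S, (v - z) ⬝ᵥ (x - z) ≤ 0) :
    sqNorm (y - z) ≤ sqNorm (u - v) := by
  have h1 := hu z hz
  have h2 := hv y hy
  -- `‖u - v‖² - ‖y - z‖² = ‖(u - v) - (y - z)‖² + 2 ⟨(u - v) - (y - z), y - z⟩`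
  have e : u - v = ((u - y) - (v - z)) + (y - z) := by abel
  rw [e, sqNorm_add]
  have h3 := sqNorm_nonneg ((u - y) - (v - z))
  have h4 : (u - y) ⬝ᵥ (z - y) = -((u - y) ⬝ᵥ (y - z)) := by rw [← dotProduct_neg, neg_sub]
  rw [sub_dotProduct]
  linarith

/-- The distance from `x` to a projection `z` of `x - g'`, when `x` is itself the projection of
`x - g`. -/
theorem sqNorm_sub_projection_le {S : Set (ι → ℝ)} {x z g g' : ι → ℝ}
    (hx : x ∈ S) (hz : z ∈ S) (hg : ∀ y ∈ S, 0 ≤ g ⬝ᵥ (y - x))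
    (hproj : ∀ y ∈ S, (x - g' - z) ⬝ᵥ (y - z) ≤ 0) : sqNorm (x - z) ≤ sqNorm (g' - g) := by
  have h := sqNorm_projection_sub_le (u := x - g) (v := x - g') hx hz (fun y hy => by
    rw [sub_sub_cancel_left, neg_dotProduct]
    linarith [hg y hy]) hproj
  rwa [sub_sub_sub_cancel_left] at h

end projection

/-! ### Polyhedra and Hoffman's error bound -/

theorem isPolyhedron_of_fintype {E κ : Type*} [AddCommGroup E] [Module ℝ E] [Fintype κ]
    (φ : κ → E →ₗ[ℝ] ℝ) (b : κ → ℝ) : IsPolyhedron {x | ∀ k, φ k x ≤ b k} := by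
  let e := Fintype.equivFin κ
  refine ⟨Fintype.card κ, fun k => φ (e.symm k), fun k => b (e.symm k), ?_⟩
  ext x
  exact ⟨fun h k => h _, fun h k => by simpa using h (e k)⟩

theorem IsPolyhedron.convex {E : Type*} [AddCommGroup E] [Module ℝ E] {S : Set E}
    (hS : IsPolyhedron S) : Convex ℝ S := by
  obtain ⟨N, φ, b, rfl⟩ := hS
  simp only [Set.ofPred_forall]
  exact convex_iInter fun k => convex_halfSpace_le (φ k).isLinear _

theorem IsPolyhedron.isClosed {ι : Type*} [Fintype ι] {S : Set (ι → ℝ)}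
    (hS : IsPolyhedron S) : IsClosed S := by
  obtain ⟨N, φ, b, rfl⟩ := hS
  simp only [Set.ofPred_forall]
  exact isClosed_iInter fun k =>
    isClosed_le (LinearMap.continuous_of_finiteDimensional (φ k)) continuous_const

/-- The functional `x ↦ v ⬝ᵥ x`, linear in `v`. -/
noncomputable def dotMap (ι : Type*) [Fintype ι] : (ι → ℝ) →ₗ[ℝ] (ι → ℝ) →ₗ[ℝ] ℝ :=
  dotProductBilin ℝ ℝ

@[simp] theorem dotMap_apply {ι : Type*} [Fintype ι] (v x : ι → ℝ) : dotMap ι v x = v ⬝ᵥ x := rfl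

/-- The coefficients of a combination of linearly independent vectors depend linearly on it. -/
theorem exists_coeff_map {V κ : Type*} [AddCommGroup V] [Module ℝ V] [Fintype κ] (J : Finset κ)
    (φ : κ → V) (h : LinearIndependent ℝ (fun k : J => φ k)) :
    ∃ L : V →ₗ[ℝ] (κ → ℝ), (∀ v, ∀ k ∉ J, L v k = 0) ∧
      ∀ σ : κ → ℝ, (∀ k ∉ J, σ k = 0) → L (∑ k, σ k • φ k) = σ := by
  classical
  obtain ⟨L, hL⟩ := LinearMap.exists_leftInverse_of_injective
    (Fintype.linearCombination ℝ (fun k : J => φ k))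
    (LinearMap.ker_eq_bot.2 (linearIndependent_iff_injective_fintypeLinearCombination.1 h))
  refine ⟨LinearMap.pi fun k => if hk : k ∈ J then (LinearMap.proj ⟨k, hk⟩).comp L else 0,
    fun v k hk => by simp [hk], fun σ hσ => ?_⟩
  have h1 : ∑ k, σ k • φ k = Fintype.linearCombination ℝ (fun k : J => φ k) (fun k => σ k) := by
    rw [Fintype.linearCombination_apply,
      ← Finset.sum_subset (Finset.subset_univ J) (fun x _ hx => by simp [hσ x hx]),
      ← Finset.sum_coe_sort]
  have h2 := LinearMap.congr_fun hL (fun k : J => σ k)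
  simp only [LinearMap.comp_apply, LinearMap.id_apply] at h2
  rw [h1]
  ext k
  rw [LinearMap.pi_apply]
  split_ifs with hk
  · simp [h2]
  · simp [hσ k hk]

/-- **Hoffman's error bound** in the sup norm: the distance to a nonempty polyhedron is at most a
constant times the largest violation of a constraint. -/
theorem hoffman {ι κ : Type*} [Fintype ι] [Fintype κ] (φ : κ → (ι → ℝ) →ₗ[ℝ] ℝ) (b : κ → ℝ)
    (hne : ∃ x, ∀ k, φ k x ≤ b k) :
    ∃ C : ℝ, 0 ≤ C ∧ ∀ (w : ι → ℝ) (t : ℝ), 0 ≤ t → (∀ k, φ k w ≤ b k + t) →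
      ∃ z, (∀ k, φ k z ≤ b k) ∧ ‖w - z‖ ≤ C * t := by
  classical
  -- one bound for the coefficients with respect to each linearly independent subfamily
  have hcoef : ∀ J : Finset κ, ∃ C : ℝ, 0 ≤ C ∧ (LinearIndependent ℝ (fun k : J => φ k) →
      ∀ (v : ι → ℝ) (σ : κ → ℝ), (∀ k ∉ J, σ k = 0) → dotMap ι v = ∑ k, σ k • φ k →
        ∑ k, σ k ≤ C * ‖v‖) := by
    intro J
    by_cases h : LinearIndependent ℝ (fun k : J => φ k)
    · obtain ⟨L, -, hL⟩ := exists_coeff_map J φ h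
      let T : (ι → ℝ) →ₗ[ℝ] ℝ := (∑ k, LinearMap.proj k).comp (L.comp (dotMap ι))
      refine ⟨‖T.toContinuousLinearMap‖, norm_nonneg _, fun _ v σ hσ hv => ?_⟩
      have h1 : T v = ∑ k, σ k := by
        simp [T, hv, hL σ hσ]
      have h2 := T.toContinuousLinearMap.le_opNorm v
      rw [LinearMap.coe_toContinuousLinearMap', h1] at h2
      exact (le_abs_self _).trans h2
    · exact ⟨0, le_rfl, fun h' => absurd h' h⟩
  choose C hC0 hC using hcoef
  refine ⟨∑ J, C J, Finset.sum_nonneg fun J _ => hC0 J, fun w t ht hw => ?_⟩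
  have hpoly : IsPolyhedron {x | ∀ k, φ k x ≤ b k} := isPolyhedron_of_fintype φ b
  obtain ⟨z, hz, hproj⟩ := exists_projection hpoly.isClosed hpoly.convex hne w
  refine ⟨z, hz, ?_⟩
  obtain ⟨ρ, hρ, hact, he⟩ := polyhedron_normal φ b z hz (dotMap ι (w - z)) (fun x hx => by
    have := hproj x hx
    rw [dotProduct_sub] at this
    simpa using this)
  obtain ⟨J, σ, hσ, hJ, hJ', hli, hsum⟩ := exists_conic_linearIndependent φ ρ hρ
  have hv : dotMap ι (w - z) = ∑ k, σ k • φ k := by rw [he, hsum]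
  have hCJ : C J ≤ ∑ J, C J := Finset.single_le_sum (fun J _ => hC0 J) (Finset.mem_univ J)
  have h1 := hC J hli (w - z) σ hJ' hv
  have h2 : sqNorm (w - z) ≤ (∑ k, σ k) * t := by
    have : sqNorm (w - z) = ∑ k, σ k * φ k (w - z) := by
      have := LinearMap.congr_fun hv (w - z)
      simp only [LinearMap.sum_apply, LinearMap.smul_apply, smul_eq_mul, dotMap_apply] at this
      exact this
    rw [this, Finset.sum_mul]
    refine Finset.sum_le_sum fun k _ => ?_
    by_cases hk : k ∈ J
    · apply mul_le_mul_of_nonneg_left _ (hσ k)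
      rw [map_sub, hact k (hJ k hk)]
      linarith [hw k]
    · simp [hJ' k hk]
  have h3 := norm_sq_le_sqNorm (w - z)
  have h4 : ‖w - z‖ ^ 2 ≤ ((∑ J, C J) * t) * ‖w - z‖ := by
    have := mul_le_mul_of_nonneg_right h1 ht
    have := mul_le_mul_of_nonneg_right hCJ (mul_nonneg ht (norm_nonneg (w - z)))
    nlinarith
  rcases (norm_nonneg (w - z)).eq_or_lt with h0 | h0
  · rw [← h0]
    exact mul_nonneg (Finset.sum_nonneg fun J _ => hC0 J) ht
  · rw [sq] at h4
    exact le_of_mul_le_mul_right h4 h0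

/-- An infeasible system of linear inequalities stays infeasible after a small relaxation. -/
theorem infeasible_gap {E κ : Type*} [AddCommGroup E] [Module ℝ E] [Fintype κ]
    (φ : κ → E →ₗ[ℝ] ℝ) (b : κ → ℝ) (hne : ¬ ∃ x, ∀ k, φ k x ≤ b k) :
    ∃ ε : ℝ, 0 < ε ∧ ∀ (w : E) (t : ℝ), (∀ k, φ k w ≤ b k + t) → ε ≤ t := by
  -- Farkas' lemma for the homogenised system gives a certificate of infeasibility
  obtain ⟨ρ, hρ, he⟩ := farkas_fintype
    (fun k => (φ k).comp (LinearMap.fst ℝ E ℝ) - b k • LinearMap.snd ℝ E ℝ)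
    (LinearMap.snd ℝ E ℝ) (by
      rintro ⟨v, r⟩ hv
      simp only [LinearMap.sub_apply, LinearMap.comp_apply, LinearMap.fst_apply,
        LinearMap.smul_apply, LinearMap.snd_apply, smul_eq_mul] at hv ⊢
      by_contra hr
      push Not at hr
      refine hne ⟨r⁻¹ • v, fun k => ?_⟩
      rw [map_smul, smul_eq_mul, inv_mul_le_iff₀ hr]
      linarith [hv k])
  have hS : 0 ≤ ∑ k, ρ k := Finset.sum_nonneg fun k _ => hρ k
  refine ⟨1 / (∑ k, ρ k + 1), by positivity, fun w t hw => ?_⟩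
  have h1 := LinearMap.congr_fun he (w, 1)
  simp only [LinearMap.sum_apply, LinearMap.sub_apply, LinearMap.comp_apply, LinearMap.fst_apply,
    LinearMap.smul_apply, LinearMap.snd_apply, smul_eq_mul, mul_one] at h1
  have h2 : (1 : ℝ) ≤ (∑ k, ρ k) * t := by
    rw [h1, Finset.sum_mul]
    exact Finset.sum_le_sum fun k _ =>
      mul_le_mul_of_nonneg_left (by linarith [hw k]) (hρ k)
  have ht : 0 < t := by
    by_contra ht
    push Not at ht
    linarith [mul_nonpos_of_nonneg_of_nonpos hS ht]
  rw [div_le_iff₀ (by positivity)]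
  nlinarith

/-! ### Finite unions of polyhedra -/

/-- A finite union of polyhedra. -/
def IsPL {E : Type*} [AddCommGroup E] [Module ℝ E] (S : Set E) : Prop :=
  ∃ (N : ℕ) (T : Fin N → Set E), (∀ k, IsPolyhedron (T k)) ∧ S = ⋃ k, T k

section PL

variable {E F : Type*} [AddCommGroup E] [Module ℝ E] [AddCommGroup F] [Module ℝ F]

theorem isPolyhedron_le (ψ : E →ₗ[ℝ] ℝ) (c : ℝ) : IsPolyhedron {x | ψ x ≤ c} := by
  have h := isPolyhedron_of_fintype (fun _ : Unit => ψ) (fun _ => c)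
  simpa using h

theorem IsPolyhedron.preimage {S : Set F} (hS : IsPolyhedron S) (f : E →ₗ[ℝ] F) :
    IsPolyhedron (f ⁻¹' S) := by
  obtain ⟨N, φ, b, rfl⟩ := hS
  exact ⟨N, fun k => (φ k).comp f, b, rfl⟩

theorem IsPolyhedron.iInter {κ : Type*} [Fintype κ] {S : κ → Set E}
    (hS : ∀ k, IsPolyhedron (S k)) : IsPolyhedron (⋂ k, S k) := by
  choose N φ b h using hS
  have := isPolyhedron_of_fintype (κ := Σ k, Fin (N k)) (fun a => φ a.1 a.2) (fun a => b a.1 a.2)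
  convert this using 1
  ext x
  simp [h, Sigma.forall]

theorem IsPolyhedron.inter {S T : Set E} (hS : IsPolyhedron S) (hT : IsPolyhedron T) :
    IsPolyhedron (S ∩ T) := by
  rw [Set.inter_eq_iInter]
  exact IsPolyhedron.iInter fun b => by cases b <;> assumption

theorem isPolyhedron_eq (ψ : E →ₗ[ℝ] ℝ) (c : ℝ) : IsPolyhedron {x | ψ x = c} := by
  convert (isPolyhedron_le ψ c).inter (isPolyhedron_le (-ψ) (-c)) using 1
  ext x
  simp [le_antisymm_iff]

theorem isPL_iUnion {κ : Type*} [Fintype κ] {T : κ → Set E} (hT : ∀ k, IsPolyhedron (T k)) :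
    IsPL (⋃ k, T k) := by
  let e := Fintype.equivFin κ
  refine ⟨Fintype.card κ, fun k => T (e.symm k), fun k => hT _, ?_⟩
  exact (e.symm.surjective.iUnion_comp T).symm

theorem IsPolyhedron.isPL {S : Set E} (hS : IsPolyhedron S) : IsPL S :=
  ⟨1, fun _ => S, fun _ => hS, (Set.iUnion_const S).symm⟩

theorem IsPL.preimage {S : Set F} (hS : IsPL S) (f : E →ₗ[ℝ] F) : IsPL (f ⁻¹' S) := by
  obtain ⟨N, T, hT, rfl⟩ := hS
  exact ⟨N, fun k => f ⁻¹' T k, fun k => (hT k).preimage f, Set.preimage_iUnion⟩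

theorem IsPL.iInter {κ : Type*} [Fintype κ] {S : κ → Set E} (hS : ∀ k, IsPL (S k)) :
    IsPL (⋂ k, S k) := by
  classical
  choose N T hT h using hS
  -- an intersection of unions is the union, over all choices of one piece each, of intersections
  have := isPL_iUnion (κ := ∀ k, Fin (N k)) (T := fun c => ⋂ k, T k (c k))
    fun c => IsPolyhedron.iInter fun k => hT k (c k)
  convert this using 1
  ext x
  simp only [h, Set.mem_iInter, Set.mem_iUnion]
  exact Classical.skolem

theorem IsPL.inter {S T : Set E} (hS : IsPL S) (hT : IsPL T) : IsPL (S ∩ T) := by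
  rw [Set.inter_eq_iInter]
  exact IsPL.iInter fun b => by cases b <;> assumption

end PL

/-- The graph of the projection on a polyhedron is a finite union of polyhedra: one for each
linearly independent set of constraints, required to be active and to generate the normal vector. -/
theorem isPL_isProj {ι : Type*} [Fintype ι] {S : Set (ι → ℝ)} (hS : IsPolyhedron S) :
    IsPL {z : (ι → ℝ) × (ι → ℝ) | IsProj S z.1 z.2} := by
  classical
  have hconv := hS.convex
  have hS' := hS
  obtain ⟨N, φ, b, rfl⟩ := hS
  choose L hL0 hL using fun J : {J : Finset (Fin N) // LinearIndependent ℝ (fun k : J => φ k)} =>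
    exists_coeff_map J.1 φ J.2
  let D : (ι → ℝ) × (ι → ℝ) →ₗ[ℝ] (ι → ℝ) →ₗ[ℝ] ℝ :=
    (dotMap ι).comp (LinearMap.fst ℝ _ _ - LinearMap.snd ℝ _ _)
  have hpoly : ∀ J, IsPolyhedron
      ((LinearMap.snd ℝ (ι → ℝ) (ι → ℝ) ⁻¹' {x | ∀ k, φ k x ≤ b k}) ∩
        ((⋂ k : J.1, {z | ((φ k).comp (LinearMap.snd ℝ (ι → ℝ) (ι → ℝ))) z = b k}) ∩
        ((⋂ k, {z | (-((LinearMap.proj k).comp ((L J).comp D))) z ≤ 0}) ∩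
        (⋂ l : ι, {z | (∑ k, (φ k (Pi.single l 1)) • ((LinearMap.proj k).comp ((L J).comp D)) -
          (LinearMap.applyₗ (Pi.single l 1)).comp D) z = 0})))) := fun J =>
    (hS'.preimage _).inter ((IsPolyhedron.iInter fun k => isPolyhedron_eq _ _).inter
      ((IsPolyhedron.iInter fun k => isPolyhedron_le _ _).inter
        (IsPolyhedron.iInter fun l => isPolyhedron_eq _ _)))
  convert isPL_iUnion hpoly using 1
  ext ⟨w, z⟩
  simp only [Set.mem_ofPred_eq, Set.mem_iUnion, Set.mem_inter_iff, Set.mem_preimage, Set.mem_iInter,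
    LinearMap.snd_apply, LinearMap.comp_apply, LinearMap.neg_apply, LinearMap.sub_apply,
    LinearMap.sum_apply, LinearMap.smul_apply, smul_eq_mul, LinearMap.proj_apply,
    LinearMap.applyₗ_apply_apply]
  rw [isProj_iff hconv]
  have hDwz : D (w, z) = dotMap ι (w - z) := rfl
  constructor
  · rintro ⟨hz, hproj⟩
    obtain ⟨ρ, hρ, hact, he⟩ := polyhedron_normal φ b z hz (dotMap ι (w - z)) (fun x hx => by
      have := hproj x hx
      rw [dotProduct_sub] at this
      simpa using this)
    obtain ⟨J, σ, hσ, hJ, hJ', hli, hsum⟩ := exists_conic_linearIndependent φ ρ hρ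
    have hv : dotMap ι (w - z) = ∑ k, σ k • φ k := by rw [he, hsum]
    have hLσ := hL ⟨J, hli⟩ σ hJ'
    refine ⟨⟨J, hli⟩, hz, fun k => hact k (hJ k k.2), fun k => ?_, fun l => ?_⟩
    · rw [hDwz, hv, hLσ]
      simpa using hσ k
    · rw [hDwz, hv, hLσ]
      simp [mul_comm]
  · rintro ⟨J, hz, hact, hnn, hrep⟩
    refine ⟨hz, fun x hx => ?_⟩
    have hrep' : D (w, z) = ∑ k, L J (D (w, z)) k • φ k := by
      refine LinearMap.pi_ext' fun l => LinearMap.ext_ring ?_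
      have := hrep l
      simp only [LinearMap.comp_apply, LinearMap.sum_apply, LinearMap.smul_apply, smul_eq_mul,
        LinearMap.coe_single]
      rw [← sub_eq_zero.1 this]
      exact Finset.sum_congr rfl fun k _ => mul_comm _ _
    have h1 := LinearMap.congr_fun hrep' (x - z)
    rw [hDwz, dotMap_apply] at h1
    rw [h1, LinearMap.sum_apply]
    refine Finset.sum_nonpos fun k _ => ?_
    rw [LinearMap.smul_apply, smul_eq_mul]
    by_cases hk : k ∈ J.1
    · have h2 := hact ⟨k, hk⟩
      have h3 := hnn k
      rw [hDwz] at h3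
      apply mul_nonpos_of_nonneg_of_nonpos (by linarith)
      rw [map_sub]
      have := hx k
      simp only at h2
      linarith
    · rw [hL0 J _ k hk, zero_mul]

/-- Linear growth of a polyhedral system near `e = 0`: the slice at `e = 0` is either approached
at a linear rate in `e`, or empty, and then so are the slices for small `e`. -/
theorem IsPolyhedron.error_bound {ι F : Type*} [Fintype ι] [NormedAddCommGroup F] [NormedSpace ℝ F]
    [FiniteDimensional ℝ F] {S : Set ((ι → ℝ) × F)} (hS : IsPolyhedron S) :
    ∃ ε : ℝ, 0 < ε ∧ ∃ C : ℝ, 0 ≤ C ∧ ∀ u e, (u, e) ∈ S → ‖e‖ ≤ ε →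
      ∃ u', (u', 0) ∈ S ∧ ‖u - u'‖ ≤ C * ‖e‖ := by
  obtain ⟨N, φ, b, rfl⟩ := hS
  let ψ : Fin N → (ι → ℝ) →ₗ[ℝ] ℝ := fun k => (φ k).comp (LinearMap.inl ℝ _ _)
  let χ : Fin N → F →L[ℝ] ℝ := fun k => ((φ k).comp (LinearMap.inr ℝ _ _)).toContinuousLinearMap
  have hsplit : ∀ k u e, φ k (u, e) = ψ k u + χ k e := by
    intro k u e
    simp only [ψ, χ, LinearMap.coe_toContinuousLinearMap', LinearMap.comp_apply,
      LinearMap.inl_apply, LinearMap.inr_apply, ← map_add]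
    simp
  set D := ∑ k, ‖χ k‖
  have hD : 0 ≤ D := Finset.sum_nonneg fun k _ => norm_nonneg _
  have hviol : ∀ u e, (∀ k, φ k (u, e) ≤ b k) → ∀ k, ψ k u ≤ b k + D * ‖e‖ := by
    intro u e h k
    have h1 := h k
    rw [hsplit] at h1
    have h2 : -χ k e ≤ ‖χ k‖ * ‖e‖ := (neg_le_abs _).trans ((χ k).le_opNorm e)
    have h3 : ‖χ k‖ ≤ D :=
      Finset.single_le_sum (f := fun k => ‖χ k‖) (fun k _ => norm_nonneg _) (Finset.mem_univ k)
    nlinarith [norm_nonneg e, mul_le_mul_of_nonneg_right h3 (norm_nonneg e)]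
  by_cases hne : ∃ x, ∀ k, ψ k x ≤ b k
  · obtain ⟨C, hC, h⟩ := hoffman ψ b hne
    refine ⟨1, one_pos, C * D, mul_nonneg hC hD, fun u e hu _ => ?_⟩
    obtain ⟨z, hz, hn⟩ := h u (D * ‖e‖) (mul_nonneg hD (norm_nonneg _)) (hviol u e hu)
    refine ⟨z, fun k => ?_, by rwa [mul_assoc]⟩
    rw [hsplit, map_zero, add_zero]
    exact hz k
  · obtain ⟨ε, hε, h⟩ := infeasible_gap ψ b hne
    refine ⟨ε / (D + 1), by positivity, 0, le_rfl, fun u e hu he => ?_⟩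
    have h1 := h u (D * ‖e‖) (hviol u e hu)
    rw [le_div_iff₀ (by positivity)] at he
    have h2 : ‖e‖ = 0 := le_antisymm (by linarith) (norm_nonneg e)
    rw [h2, mul_zero] at h1
    exact absurd h1 (not_le.2 hε)

/-- **Robinson's upper Lipschitz property** of piecewise linear multifunctions. -/
theorem IsPL.error_bound {ι F : Type*} [Fintype ι] [NormedAddCommGroup F] [NormedSpace ℝ F]
    [FiniteDimensional ℝ F] {S : Set ((ι → ℝ) × F)} (hS : IsPL S) :
    ∃ ε : ℝ, 0 < ε ∧ ∃ C : ℝ, 0 ≤ C ∧ ∀ u e, (u, e) ∈ S → ‖e‖ ≤ ε →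
      ∃ u', (u', 0) ∈ S ∧ ‖u - u'‖ ≤ C * ‖e‖ := by
  obtain ⟨N, T, hT, rfl⟩ := hS
  choose ε hε C hC h using fun k => (hT k).error_bound
  obtain ⟨ε₀, hε₀, hle⟩ : ∃ ε₀ : ℝ, 0 < ε₀ ∧ ∀ k, ε₀ ≤ ε k := by
    rcases isEmpty_or_nonempty (Fin N) with hN | hN
    · exact ⟨1, one_pos, fun k => hN.elim k⟩
    · obtain ⟨k, hk⟩ := Finite.exists_min ε
      exact ⟨ε k, hε k, hk⟩
  refine ⟨ε₀, hε₀, ∑ k, C k, Finset.sum_nonneg fun k _ => hC k, fun u e hu he => ?_⟩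
  obtain ⟨k, hk⟩ := Set.mem_iUnion.1 hu
  obtain ⟨u', hu', hn⟩ := h k u e hk (he.trans (hle k))
  exact ⟨u', Set.mem_iUnion.2 ⟨k, hu'⟩, hn.trans (mul_le_mul_of_nonneg_right
    (Finset.single_le_sum (fun k _ => hC k) (Finset.mem_univ k)) (norm_nonneg e))⟩

/-! ### Subgradients -/

/-- The **Moreau–Rockafellar sum rule** for a finite convex function, a linear function and the
indicator of a convex set: a minimiser of `f + ⟨g, ·⟩` over `X` admits a subgradient `ξ` of `f` with
`-(ξ + g)` normal to `X`. -/
theorem exists_subgradient {ι : Type*} [Fintype ι] {f : (ι → ℝ) → ℝ} (hf : ConvexOn ℝ Set.univ f)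
    {X : Set (ι → ℝ)} (hX : Convex ℝ X) {x₀ : ι → ℝ} (hx₀ : x₀ ∈ X) (g : ι → ℝ)
    (hmin : ∀ x ∈ X, 0 ≤ f x - f x₀ + g ⬝ᵥ (x - x₀)) :
    ∃ ξ ∈ subdiff f x₀, ∀ x ∈ X, 0 ≤ (ξ + g) ⬝ᵥ (x - x₀) := by
  classical
  have hcont : Continuous f := hf.locallyLipschitz.continuous
  -- separate the strict epigraph of `f - f x₀ + ⟨g, · - x₀⟩` from `X × (-∞, 0]`
  let q : (ι → ℝ) → ℝ := fun x => f x - f x₀ + g ⬝ᵥ (x - x₀)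
  have hq : ConvexOn ℝ Set.univ q := by
    have h1 : ConvexOn ℝ Set.univ (fun x : ι → ℝ => g ⬝ᵥ x) :=
      (dotMap ι g).convexOn convex_univ
    refine ((hf.add h1).add_const (-f x₀ - g ⬝ᵥ x₀)).congr fun x _ => ?_
    simp only [q, Pi.add_apply, dotProduct_sub]
    ring
  have hqc : Continuous q := by
    simp only [q, dotProduct]
    fun_prop
  let C₁ : Set ((ι → ℝ) × ℝ) := {z | q z.1 < z.2}
  have hC₁ : Convex ℝ C₁ := by
    have := hq.convex_strict_epigraph
    simpa [C₁] using this
  have hC₁o : IsOpen C₁ := isOpen_lt (hqc.comp continuous_fst) continuous_snd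
  have hdisj : Disjoint C₁ (X ×ˢ Set.Iic (0 : ℝ)) := by
    rw [Set.disjoint_left]
    rintro ⟨x, t⟩ h1 ⟨h2, h3⟩
    have h4 := hmin x h2
    have h5 : q x < t := h1
    have h6 : t ≤ 0 := h3
    simp only [q] at h5
    linarith
  obtain ⟨F, u, hF₁, hF₂⟩ := geometric_hahn_banach_open hC₁ hC₁o (hX.prod (convex_Iic 0)) hdisj
  have hsplit : ∀ x t, F (x, t) = F (x, 0) + t * F (0, 1) := by
    intro x t
    rw [← smul_eq_mul, ← map_smul, ← map_add]
    simp
  set α := F (0, 1) with hα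
  have hq₀ : q x₀ = 0 := by simp [q]
  have hu₀ : u ≤ F (x₀, 0) := hF₂ _ ⟨hx₀, Set.mem_Iic.2 le_rfl⟩
  have hα0 : α < 0 := by
    have h := hF₁ (x₀, 1) (by simp [C₁, hq₀])
    rw [hsplit, one_mul] at h
    linarith
  have hle : ∀ x, F (x, 0) + q x * α ≤ u := by
    intro x
    by_contra hlt
    push Not at hlt
    have h := hF₁ (x, q x + (F (x, 0) + q x * α - u) / (-α))
      (by
        have : 0 < (F (x, 0) + q x * α - u) / (-α) := div_pos (by linarith) (by linarith)
        simpa [C₁] using this)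
    rw [hsplit, add_mul, div_mul_eq_mul_div, div_neg, mul_div_cancel_right₀ _ hα0.ne] at h
    linarith
  have hu : u = F (x₀, 0) := by
    have := hle x₀
    rw [hq₀] at this
    linarith
  let ℓ : ι → ℝ := fun i => F (Pi.single i 1, 0) / (-α)
  have hℓ : ∀ x, ℓ ⬝ᵥ x = F (x, 0) / (-α) := by
    intro x
    have h := LinearMap.pi_apply_eq_sum_univ
      ((F : (ι → ℝ) × ℝ →ₗ[ℝ] ℝ).comp (LinearMap.inl ℝ (ι → ℝ) ℝ)) x
    simp only [LinearMap.comp_apply, LinearMap.inl_apply, ContinuousLinearMap.coe_coe,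
      smul_eq_mul] at h
    rw [h, Finset.sum_div]
    refine Finset.sum_congr rfl fun i _ => ?_
    simp only [ℓ]
    rw [div_mul_eq_mul_div, mul_comm]
    congr 4
    ext j
    simp [Pi.single_apply, eq_comm]
  refine ⟨ℓ - g, fun x => ?_, fun x hx => ?_⟩
  · have h := hle x
    rw [hu] at h
    have h2 : ℓ ⬝ᵥ (x - x₀) ≤ q x := by
      rw [dotProduct_sub, hℓ, hℓ, ← sub_div, div_le_iff₀ (by linarith)]
      linarith
    simp only [q] at h2
    rw [sub_dotProduct]
    linarith
  · rw [sub_add_cancel, dotProduct_sub, hℓ, hℓ, ← sub_div]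
    have := hF₂ (x, 0) ⟨hx, Set.mem_Iic.2 le_rfl⟩
    exact div_nonneg (by linarith) (by linarith)

theorem subdiff_nonempty {ι : Type*} [Fintype ι] {f : (ι → ℝ) → ℝ} (hf : ConvexOn ℝ Set.univ f)
    (x : ι → ℝ) : (subdiff f x).Nonempty := by
  obtain ⟨ξ, hξ, -⟩ := exists_subgradient hf (convex_singleton x) rfl 0 (by simp)
  exact ⟨ξ, hξ⟩

/-! ### Extreme eigenvalues and weighted distances -/

section eigen

variable {ι : Type*} [Fintype ι] [DecidableEq ι] {H : Matrix ι ι ℝ}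

theorem lamMin_mul_sqNorm_le (hH : H.IsHermitian) (v : ι → ℝ) :
    lamMin H * sqNorm v ≤ sqNormW H v := by
  have hbdd : BddBelow (spectrum ℝ H) := Matrix.finite_real_spectrum.bddBelow
  have h : (H - algebraMap ℝ (Matrix ι ι ℝ) (lamMin H)).PosSemidef := by
    rw [Matrix.posSemidef_iff_isHermitian_and_spectrum_nonneg]
    refine ⟨hH.sub ?_, ?_⟩
    · rw [Matrix.algebraMap_eq_diagonal]
      exact Matrix.isHermitian_diagonal _
    · rw [← spectrum.sub_singleton_eq]
      rintro _ ⟨a, ha, b, rfl, rfl⟩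
      exact sub_nonneg.2 (csInf_le hbdd ha)
  have := h.dotProduct_mulVec_nonneg v
  rw [Matrix.sub_mulVec, dotProduct_sub, Algebra.algebraMap_eq_smul_one, Matrix.smul_mulVec,
    Matrix.one_mulVec, dotProduct_smul, star_trivial, smul_eq_mul] at this
  exact sub_nonneg.1 this

theorem sqNormW_le_lamMax_mul (hH : H.IsHermitian) (v : ι → ℝ) :
    sqNormW H v ≤ lamMax H * sqNorm v := by
  have hbdd : BddAbove (spectrum ℝ H) := Matrix.finite_real_spectrum.bddAbove
  have h : (algebraMap ℝ (Matrix ι ι ℝ) (lamMax H) - H).PosSemidef := by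
    rw [Matrix.posSemidef_iff_isHermitian_and_spectrum_nonneg]
    refine ⟨Matrix.IsHermitian.sub ?_ hH, ?_⟩
    · rw [Matrix.algebraMap_eq_diagonal]
      exact Matrix.isHermitian_diagonal _
    · rw [← spectrum.singleton_sub_eq]
      rintro _ ⟨b, rfl, a, ha, rfl⟩
      exact sub_nonneg.2 (le_csSup hbdd ha)
  have := h.dotProduct_mulVec_nonneg v
  rw [Matrix.sub_mulVec, dotProduct_sub, Algebra.algebraMap_eq_smul_one, Matrix.smul_mulVec,
    Matrix.one_mulVec, dotProduct_smul, star_trivial, smul_eq_mul] at this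
  exact sub_nonneg.1 this

theorem lamMin_pos [Nonempty ι] (hH : H.PosDef) : 0 < lamMin H := by
  have hs := hH.isHermitian.spectrum_real_eq_range_eigenvalues
  have hne : (spectrum ℝ H).Nonempty := by
    rw [hs]
    exact Set.range_nonempty _
  have hmem : lamMin H ∈ spectrum ℝ H := hne.csInf_mem Matrix.finite_real_spectrum
  rw [hs] at hmem
  obtain ⟨i, hi⟩ := hmem
  rw [← hi]
  exact hH.eigenvalues_pos i

theorem lamMax_pos [Nonempty ι] (hH : H.PosDef) : 0 < lamMax H := by
  obtain ⟨i⟩ := ‹Nonempty ι›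
  have h1 := hH.eigenvalues_pos i
  have h2 := hH.isHermitian.eigenvalues_mem_spectrum_real i
  exact h1.trans_le (le_csSup Matrix.finite_real_spectrum.bddAbove h2)

omit [DecidableEq ι] in
theorem sqNormW_nonneg (hH : H.PosSemidef) (v : ι → ℝ) : 0 ≤ sqNormW H v :=
  hH.dotProduct_mulVec_nonneg v

theorem sqNormW_one (v : ι → ℝ) : sqNormW 1 v = sqNorm v := by
  simp [sqNormW, sqNorm]

omit [DecidableEq ι] in
theorem distSq_le (hH : H.PosSemidef) {S : Set (ι → ℝ)} {v : ι → ℝ} (hv : v ∈ S) (w : ι → ℝ) :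
    distSq H w S ≤ sqNormW H (w - v) := by
  refine csInf_le ⟨0, ?_⟩ ⟨v, hv, rfl⟩
  rintro _ ⟨u, -, rfl⟩
  exact sqNormW_nonneg hH _

omit [DecidableEq ι] in
theorem le_distSq {S : Set (ι → ℝ)} (hS : S.Nonempty) {w : ι → ℝ} {c : ℝ}
    (h : ∀ v ∈ S, c ≤ sqNormW H (w - v)) : c ≤ distSq H w S := by
  refine le_csInf (hS.image _) ?_
  rintro _ ⟨v, hv, rfl⟩
  exact h v hv

theorem distSq_one_le {S : Set (ι → ℝ)} {v : ι → ℝ} (hv : v ∈ S) (w : ι → ℝ) :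
    distSq 1 w S ≤ sqNorm (w - v) := by
  rw [← sqNormW_one]
  exact distSq_le Matrix.PosSemidef.one hv w

theorem lamMin_mul_distSq_le (hH : H.PosDef) (h0 : 0 ≤ lamMin H) {S : Set (ι → ℝ)}
    (hS : S.Nonempty) (w : ι → ℝ) : lamMin H * distSq 1 w S ≤ distSq H w S :=
  le_distSq hS fun _ hv => (mul_le_mul_of_nonneg_left (distSq_one_le hv w) h0).trans
    (lamMin_mul_sqNorm_le hH.isHermitian _)

theorem distSq_le_lamMax_mul (hH : H.PosDef) (h0 : 0 < lamMax H) {S : Set (ι → ℝ)}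
    (hS : S.Nonempty) (w : ι → ℝ) : distSq H w S ≤ lamMax H * distSq 1 w S := by
  rw [← div_le_iff₀' h0]
  refine le_distSq hS fun v hv => ?_
  rw [div_le_iff₀' h0, sqNormW_one]
  exact (distSq_le hH.posSemidef hv w).trans (sqNormW_le_lamMax_mul hH.isHermitian _)

end eigen

section gram

variable {ι κ : Type*} [Fintype ι] [Fintype κ] [DecidableEq κ] (A : Matrix ι κ ℝ)

omit [DecidableEq κ] in
theorem dotProduct_transpose_mulVec (x : κ → ℝ) (l : ι → ℝ) :
    x ⬝ᵥ (Aᵀ *ᵥ l) = l ⬝ᵥ (A *ᵥ x) := by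
  rw [Matrix.mulVec_transpose, dotProduct_comm, ← Matrix.dotProduct_mulVec]

theorem sqNorm_mulVec_le (x : κ → ℝ) : sqNorm (A *ᵥ x) ≤ lamMax (Aᵀ * A) * sqNorm x := by
  have hH : (Aᵀ * A).IsHermitian := by
    simpa using Matrix.isHermitian_conjTranspose_mul_self A
  have h := sqNormW_le_lamMax_mul hH x
  rwa [sqNormW, ← Matrix.mulVec_mulVec, dotProduct_transpose_mulVec] at h

theorem lamMax_gram_nonneg : 0 ≤ lamMax (Aᵀ * A) := by
  rcases isEmpty_or_nonempty κ with hκ | ⟨⟨k⟩⟩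
  · have : spectrum ℝ (Aᵀ * A) = ∅ := spectrum.of_subsingleton _
    rw [lamMax, this, Real.sSup_empty]
  · have h5 := (sqNorm_nonneg _).trans (sqNorm_mulVec_le A (Pi.single k 1))
    have h6 : sqNorm (Pi.single k 1 : κ → ℝ) = 1 := by simp [sqNorm]
    rwa [h6, mul_one] at h5

theorem sqNorm_transpose_mulVec_le (l : ι → ℝ) :
    sqNorm (Aᵀ *ᵥ l) ≤ lamMax (Aᵀ * A) * sqNorm l := by
  have h1 : sqNorm (Aᵀ *ᵥ l) = l ⬝ᵥ (A *ᵥ (Aᵀ *ᵥ l)) := by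
    rw [sqNorm, dotProduct_transpose_mulVec]
  have h2 := dotProduct_sq_le l (A *ᵥ (Aᵀ *ᵥ l))
  have h3 := sqNorm_mulVec_le A (Aᵀ *ᵥ l)
  rw [← h1] at h2
  have h4 := mul_le_mul_of_nonneg_left h3 (sqNorm_nonneg l)
  rcases (sqNorm_nonneg (Aᵀ *ᵥ l)).eq_or_lt with h0 | h0
  · rw [← h0]
    exact mul_nonneg (lamMax_gram_nonneg A) (sqNorm_nonneg l)
  · have : sqNorm (Aᵀ *ᵥ l) * sqNorm (Aᵀ *ᵥ l)
        ≤ (lamMax (Aᵀ * A) * sqNorm l) * sqNorm (Aᵀ *ᵥ l) := by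
      nlinarith
    exact le_of_mul_le_mul_right this h0

omit [Fintype ι] [DecidableEq κ] in
theorem mulVec_eq_zero_of_rank {x : κ → ℝ} (hA : A.rank = Fintype.card κ) (hx : A *ᵥ x = 0) :
    x = 0 := by
  have h := A.mulVecLin.finrank_range_add_finrank_ker
  rw [Module.finrank_fintype_fun_eq_card] at h
  have h0 : Module.finrank ℝ (LinearMap.ker A.mulVecLin) = 0 := by
    have : A.rank = Module.finrank ℝ (LinearMap.range A.mulVecLin) := rfl
    omega
  have hk : LinearMap.ker A.mulVecLin = ⊥ := Submodule.finrank_eq_zero.1 h0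
  have hm : x ∈ LinearMap.ker A.mulVecLin := hx
  rwa [hk, Submodule.mem_bot] at hm

end gram

/-! ### Block coordinates -/

section blocks

variable {n p q : ℕ} {m : Fin p → ℕ} {d : Fin q → ℕ}

@[simp] theorem xPart_sub (u v : WVec n m d) (i : Fin p) :
    xPart (u - v) i = xPart u i - xPart v i := rfl

@[simp] theorem yPart_sub (u v : WVec n m d) (j : Fin q) :
    yPart (u - v) j = yPart u j - yPart v j := rfl

@[simp] theorem lamPart_sub (u v : WVec n m d) : lamPart (u - v) = lamPart u - lamPart v := rfl

theorem dotProduct_bIdx (u v : BIdx m → ℝ) :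
    u ⬝ᵥ v = ∑ i, (fun r => u ⟨i, r⟩) ⬝ᵥ (fun r => v ⟨i, r⟩) :=
  Fintype.sum_sigma _

theorem dotProduct_wVec (u v : WVec n m d) :
    u ⬝ᵥ v = ∑ i, xPart u i ⬝ᵥ xPart v i + ∑ j, yPart u j ⬝ᵥ yPart v j
      + lamPart u ⬝ᵥ lamPart v := by
  rw [Matrix.dotProduct_block, Matrix.dotProduct_block, dotProduct_bIdx, dotProduct_bIdx,
    add_assoc]
  rfl

/-- The vector with blocks `xᵢ`, `yⱼ` and `lam`. -/
def ofBlocks (x : ∀ i, Fin (m i) → ℝ) (y : ∀ j, Fin (d j) → ℝ) (lam : Fin n → ℝ) : WVec n m d :=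
  Sum.elim (fun a => x a.1 a.2) (Sum.elim (fun b => y b.1 b.2) lam)

@[simp] theorem xPart_ofBlocks (x : ∀ i, Fin (m i) → ℝ) (y : ∀ j, Fin (d j) → ℝ)
    (lam : Fin n → ℝ) : xPart (ofBlocks x y lam) = x := rfl

@[simp] theorem yPart_ofBlocks (x : ∀ i, Fin (m i) → ℝ) (y : ∀ j, Fin (d j) → ℝ)
    (lam : Fin n → ℝ) : yPart (ofBlocks x y lam) = y := rfl

@[simp] theorem lamPart_ofBlocks (x : ∀ i, Fin (m i) → ℝ) (y : ∀ j, Fin (d j) → ℝ)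
    (lam : Fin n → ℝ) : lamPart (ofBlocks x y lam) = lam := rfl

/-- The block `xᵢ` as a linear map. -/
def xMap (n : ℕ) (m : Fin p → ℕ) (d : Fin q → ℕ) (i : Fin p) :
    WVec n m d →ₗ[ℝ] (Fin (m i) → ℝ) :=
  LinearMap.funLeft ℝ ℝ fun r => Sum.inl ⟨i, r⟩

/-- The block `yⱼ` as a linear map. -/
def yMap (n : ℕ) (m : Fin p → ℕ) (d : Fin q → ℕ) (j : Fin q) :
    WVec n m d →ₗ[ℝ] (Fin (d j) → ℝ) :=
  LinearMap.funLeft ℝ ℝ fun r => Sum.inr (Sum.inl ⟨j, r⟩)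

/-- The multiplier block as a linear map. -/
def lamMap (n : ℕ) (m : Fin p → ℕ) (d : Fin q → ℕ) : WVec n m d →ₗ[ℝ] (Fin n → ℝ) :=
  LinearMap.funLeft ℝ ℝ fun r => Sum.inr (Sum.inr r)

end blocks

namespace Problem

variable {n p q : ℕ} {m : Fin p → ℕ} {d : Fin q → ℕ} (P : Problem n m d)

/-! ### The variational inequality and its solutions -/

/-- The linear part of the constraint residual. -/
noncomputable def residMap : WVec n m d →ₗ[ℝ] (Fin n → ℝ) :=
  ∑ i, (P.A i).mulVecLin.comp (xMap n m d i) + ∑ j, (P.B j).mulVecLin.comp (yMap n m d j)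

theorem residMap_apply (w : WVec n m d) :
    P.residMap w = ∑ i, P.A i *ᵥ xPart w i + ∑ j, P.B j *ᵥ yPart w j := by
  simp only [residMap, LinearMap.add_apply, LinearMap.sum_apply]
  rfl

theorem resid_eq (w : WVec n m d) : P.resid (xPart w) (yPart w) = P.residMap w - P.c := by
  rw [residMap_apply, resid]

theorem resid_sub_resid (w v : WVec n m d) :
    P.resid (xPart w) (yPart w) - P.resid (xPart v) (yPart v)
      = ∑ i, P.A i *ᵥ (xPart w i - xPart v i) + ∑ j, P.B j *ᵥ (yPart w j - yPart v j) := by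
  rw [resid_eq, resid_eq, sub_sub_sub_cancel_right, ← map_sub, residMap_apply]
  rfl

/-- The multiplier paired with the change of the residual, block by block. -/
theorem dotProduct_resid_sub (l : Fin n → ℝ) (w v : WVec n m d) :
    ∑ i, (xPart w i - xPart v i) ⬝ᵥ ((P.A i)ᵀ *ᵥ l)
        + ∑ j, (yPart w j - yPart v j) ⬝ᵥ ((P.B j)ᵀ *ᵥ l)
      = l ⬝ᵥ P.resid (xPart w) (yPart w) - l ⬝ᵥ P.resid (xPart v) (yPart v) := by
  rw [← dotProduct_sub, resid_sub_resid, dotProduct_add, dotProduct_sum, dotProduct_sum]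
  simp only [dotProduct_transpose_mulVec]

theorem sub_dotProduct_J (w v u : WVec n m d) :
    (w - v) ⬝ᵥ P.J u = -(lamPart u ⬝ᵥ P.resid (xPart w) (yPart w)
        - lamPart u ⬝ᵥ P.resid (xPart v) (yPart v))
      + (lamPart w - lamPart v) ⬝ᵥ P.resid (xPart u) (yPart u) := by
  rw [← dotProduct_resid_sub, dotProduct_wVec]
  have hx : ∀ i, xPart (P.J u) i = -((P.A i)ᵀ *ᵥ lamPart u) := fun i => rfl
  have hy : ∀ j, yPart (P.J u) j = -((P.B j)ᵀ *ᵥ lamPart u) := fun j => rfl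
  have hl : lamPart (P.J u) = P.resid (xPart u) (yPart u) := rfl
  simp only [hx, hy, hl, xPart_sub, yPart_sub, lamPart_sub, dotProduct_neg, Finset.sum_neg_distrib]
  ring

/-- `𝒥` is affine with skew-symmetric linear part. -/
theorem sub_dotProduct_J_self (w v : WVec n m d) :
    (w - v) ⬝ᵥ P.J w = lamPart w ⬝ᵥ P.resid (xPart v) (yPart v)
      - lamPart v ⬝ᵥ P.resid (xPart w) (yPart w) := by
  rw [sub_dotProduct_J, sub_dotProduct]
  ring

theorem mem_solSet_of_multiplier {v : WVec n m d} (hv : v ∈ P.feasW)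
    (hr : P.resid (xPart v) (yPart v) = 0)
    (h : ∀ w ∈ P.feasW, lamPart v ⬝ᵥ P.resid (xPart w) (yPart w)
      ≤ P.obj (xPart w) (yPart w) - P.obj (xPart v) (yPart v)) : v ∈ P.solSet := by
  refine ⟨hv, fun w hw => ?_⟩
  rw [sub_dotProduct_J_self, hr, dotProduct_zero]
  linarith [h w hw]

theorem isPolyhedron_feasW (hX : ∀ i, IsPolyhedron (P.X i)) (hY : ∀ j, IsPolyhedron (P.Y j)) :
    IsPolyhedron P.feasW := by
  have h := (IsPolyhedron.iInter fun i => (hX i).preimage (xMap n m d i)).inter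
    (IsPolyhedron.iInter fun j => (hY j).preimage (yMap n m d j))
  convert h using 1
  ext w
  simp only [Set.mem_inter_iff, Set.mem_iInter]
  rfl

theorem convexOn_obj (hf : ∀ i, ConvexOn ℝ Set.univ (P.f i))
    (hg : ∀ j, ConvexOn ℝ Set.univ (P.g j)) :
    ConvexOn ℝ Set.univ (fun w : WVec n m d => P.obj (xPart w) (yPart w)) := by
  refine ⟨convex_univ, fun u _ v _ a b ha hb hab => ?_⟩
  simp only [obj, smul_add, Finset.smul_sum, add_add_add_comm, ← Finset.sum_add_distrib]
  have hx : ∀ i, xPart (a • u + b • v) i = a • xPart u i + b • xPart v i := fun i => rfl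
  have hy : ∀ j, yPart (a • u + b • v) j = a • yPart u j + b • yPart v j := fun j => rfl
  simp only [hx, hy]
  exact add_le_add
    (Finset.sum_le_sum fun i _ => (hf i).2 (Set.mem_univ _) (Set.mem_univ _) ha hb hab)
    (Finset.sum_le_sum fun j _ => (hg j).2 (Set.mem_univ _) (Set.mem_univ _) ha hb hab)

/-- Existence of Lagrange multipliers: since all constraints are polyhedral, no constraint
qualification is needed. -/
theorem solSet_nonempty (hf : ∀ i, ConvexOn ℝ Set.univ (P.f i))
    (hg : ∀ j, ConvexOn ℝ Set.univ (P.g j))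
    (hX : ∀ i, IsPolyhedron (P.X i)) (hY : ∀ j, IsPolyhedron (P.Y j))
    (hsol : ∃ x y, P.IsSolution x y) : P.solSet.Nonempty := by
  obtain ⟨x, y, ⟨hx, hy, hr⟩, hopt⟩ := hsol
  obtain ⟨N, φ, b, hφ⟩ := P.isPolyhedron_feasW hX hY
  set w₀ : WVec n m d := ofBlocks x y 0 with hw₀
  have hw₀F : w₀ ∈ P.feasW := ⟨hx, hy⟩
  have hr₀ : P.resid (xPart w₀) (yPart w₀) = 0 := hr
  have hm₀ : P.residMap w₀ = P.c := by rwa [resid_eq, sub_eq_zero] at hr₀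
  -- the constraints `φ k w ≤ b k` of `ℳ`, followed by the equations as pairs of inequalities
  let Φ : Fin N ⊕ (Fin n ⊕ Fin n) → WVec n m d →ₗ[ℝ] ℝ :=
    Sum.elim φ (Sum.elim (fun r => (LinearMap.proj r).comp P.residMap)
      (fun r => -(LinearMap.proj r).comp P.residMap))
  let β : Fin N ⊕ (Fin n ⊕ Fin n) → ℝ := Sum.elim b (Sum.elim P.c (-P.c))
  have hmem : ∀ w, (∀ k, Φ k w ≤ β k) ↔ w ∈ P.feasW ∧ P.resid (xPart w) (yPart w) = 0 := by
    intro w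
    rw [resid_eq, sub_eq_zero, hφ]
    simp only [Sum.forall, Φ, β, Sum.elim_inl, Sum.elim_inr, LinearMap.comp_apply,
      LinearMap.proj_apply, LinearMap.neg_apply, Pi.neg_apply, neg_le_neg_iff, Set.mem_ofPred_eq,
      ← forall_and, ← le_antisymm_iff, funext_iff]
  obtain ⟨ξ, hξ, hn⟩ := exists_subgradient (P.convexOn_obj hf hg)
    (isPolyhedron_of_fintype Φ β).convex (x₀ := w₀) ((hmem w₀).2 ⟨hw₀F, hr₀⟩) 0 (by
      intro w hw
      obtain ⟨hwF, hwr⟩ := (hmem w).1 hw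
      have := hopt (xPart w) (yPart w) ⟨hwF.1, hwF.2, hwr⟩
      rw [zero_dotProduct, add_zero, sub_nonneg]
      exact this)
  obtain ⟨ρ, hρ, hact, he⟩ := polyhedron_normal Φ β w₀ ((hmem w₀).2 ⟨hw₀F, hr₀⟩)
    (-dotMap _ ξ) (by
      intro w hw
      have := hn w hw
      rw [add_zero, dotProduct_sub] at this
      simp only [LinearMap.neg_apply, dotMap_apply]
      linarith)
  let lam : Fin n → ℝ := fun r => ρ (Sum.inr (Sum.inr r)) - ρ (Sum.inr (Sum.inl r))
  refine ⟨ofBlocks x y lam, P.mem_solSet_of_multiplier hw₀F hr fun w hw => ?_⟩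
  have h1 := hξ w
  have h2 := LinearMap.congr_fun he (w - w₀)
  simp only [LinearMap.neg_apply, dotMap_apply, Fintype.sum_sum_type, LinearMap.add_apply,
    LinearMap.sum_apply, LinearMap.smul_apply, smul_eq_mul, Φ, Sum.elim_inl, Sum.elim_inr,
    LinearMap.comp_apply, LinearMap.proj_apply] at h2
  have h3 : ∑ k, ρ (Sum.inl k) * φ k (w - w₀) ≤ 0 := by
    refine Finset.sum_nonpos fun k _ => ?_
    by_cases hk : ρ (Sum.inl k) = 0
    · rw [hk, zero_mul]
    · have h4 : φ k w₀ = b k := hact _ hk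
      have h5 : φ k w ≤ b k := by
        rw [hφ] at hw
        exact hw k
      rw [map_sub, h4]
      exact mul_nonpos_of_nonneg_of_nonpos (hρ _) (by linarith)
  have h6 : lam ⬝ᵥ P.resid (xPart w) (yPart w)
      = ∑ r, ρ (Sum.inr (Sum.inr r)) * P.residMap (w - w₀) r
        - ∑ r, ρ (Sum.inr (Sum.inl r)) * P.residMap (w - w₀) r := by
    rw [resid_eq, ← hm₀, ← map_sub, ← Finset.sum_sub_distrib]
    exact Finset.sum_congr rfl fun r _ => sub_mul _ _ _
  simp only [lamPart_ofBlocks, xPart_ofBlocks, yPart_ofBlocks]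
  rw [h6]
  simp only [mul_neg, Finset.sum_neg_distrib] at h2
  have h7 : P.obj (xPart w₀) (yPart w₀) = P.obj x y := rfl
  simp only [h7] at h1
  linarith

/-! ### The error bound -/

/-- The graph of the residual map `w ↦ e_ℳ(w, 1)`, with the subgradients `g` kept as extra
variables: its points are `((w, g), e)`. The multiplier block of `g` is unused. -/
def errGraph : Set ((WIdx n m d ⊕ WIdx n m d → ℝ) × WVec n m d) :=
  {z | let w : WVec n m d := fun a => z.1 (Sum.inl a)
    let g : WVec n m d := fun a => z.1 (Sum.inr a)
    (∀ i, xPart g i ∈ subdiff (P.f i) (xPart w i) ∧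
      IsProj (P.X i) (xPart w i - (xPart g i - (P.A i)ᵀ *ᵥ lamPart w)) (xPart w i - xPart z.2 i)) ∧
    (∀ j, yPart g j ∈ subdiff (P.g j) (yPart w j) ∧
      IsProj (P.Y j) (yPart w j - (yPart g j - (P.B j)ᵀ *ᵥ lamPart w)) (yPart w j - yPart z.2 j)) ∧
    lamPart z.2 = P.resid (xPart w) (yPart w)}

theorem isPL_errGraph (hX : ∀ i, IsPolyhedron (P.X i)) (hY : ∀ j, IsPolyhedron (P.Y j))
    (hfs : ∀ i, IsPiecewiseLinear (subdiff (P.f i)))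
    (hgs : ∀ j, IsPiecewiseLinear (subdiff (P.g j))) : IsPL P.errGraph := by
  let W : (WIdx n m d ⊕ WIdx n m d → ℝ) × WVec n m d →ₗ[ℝ] WVec n m d :=
    (LinearMap.funLeft ℝ ℝ Sum.inl).comp (LinearMap.fst ℝ _ _)
  let G : (WIdx n m d ⊕ WIdx n m d → ℝ) × WVec n m d →ₗ[ℝ] WVec n m d :=
    (LinearMap.funLeft ℝ ℝ Sum.inr).comp (LinearMap.fst ℝ _ _)
  let E : (WIdx n m d ⊕ WIdx n m d → ℝ) × WVec n m d →ₗ[ℝ] WVec n m d := LinearMap.snd ℝ _ _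
  have hx : ∀ i, IsPL ((((xMap n m d i).comp W).prod ((xMap n m d i).comp G) ⁻¹'
      {z | z.2 ∈ subdiff (P.f i) z.1}) ∩
      (((xMap n m d i).comp W - ((xMap n m d i).comp G
        - (P.A i)ᵀ.mulVecLin.comp ((lamMap n m d).comp W))).prod
        ((xMap n m d i).comp W - (xMap n m d i).comp E) ⁻¹' {z | IsProj (P.X i) z.1 z.2})) :=
    fun i => (IsPL.preimage (hfs i) _).inter ((isPL_isProj (hX i)).preimage _)
  have hy : ∀ j, IsPL ((((yMap n m d j).comp W).prod ((yMap n m d j).comp G) ⁻¹'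
      {z | z.2 ∈ subdiff (P.g j) z.1}) ∩
      (((yMap n m d j).comp W - ((yMap n m d j).comp G
        - (P.B j)ᵀ.mulVecLin.comp ((lamMap n m d).comp W))).prod
        ((yMap n m d j).comp W - (yMap n m d j).comp E) ⁻¹' {z | IsProj (P.Y j) z.1 z.2})) :=
    fun j => (IsPL.preimage (hgs j) _).inter ((isPL_isProj (hY j)).preimage _)
  have hl : IsPL (⋂ r : Fin n, {z | ((LinearMap.proj r).comp
      (P.residMap.comp W - (lamMap n m d).comp E)) z = P.c r}) :=
    (IsPolyhedron.iInter fun r => isPolyhedron_eq _ _).isPL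
  convert (IsPL.iInter hx).inter ((IsPL.iInter hy).inter hl) using 1
  ext ⟨u, e⟩
  simp only [errGraph, resid_eq, Set.mem_inter_iff, Set.mem_iInter]
  refine and_congr Iff.rfl (and_congr Iff.rfl ?_)
  rw [funext_iff]
  refine forall_congr' fun r => ?_
  have h : ((LinearMap.proj r).comp (P.residMap.comp W - (lamMap n m d).comp E)) (u, e)
      = P.residMap (fun a => u (Sum.inl a)) r - lamPart e r := rfl
  rw [Set.mem_ofPred_eq, h, Pi.sub_apply]
  constructor <;> intro h' <;> linarith

theorem mem_solSet_of_errGraph (hX : ∀ i, IsPolyhedron (P.X i)) (hY : ∀ j, IsPolyhedron (P.Y j))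
    {u : WIdx n m d ⊕ WIdx n m d → ℝ} (hu : (u, 0) ∈ P.errGraph) :
    (fun a => u (Sum.inl a)) ∈ P.solSet := by
  obtain ⟨hx, hy, hl⟩ := hu
  set v : WVec n m d := fun a => u (Sum.inl a)
  set g : WVec n m d := fun a => u (Sum.inr a)
  have hr : P.resid (xPart v) (yPart v) = 0 := hl.symm
  have hx' : ∀ i, xPart v i ∈ P.X i ∧ ∀ z ∈ P.X i,
      ((P.A i)ᵀ *ᵥ lamPart v - xPart g i) ⬝ᵥ (z - xPart v i) ≤ 0 := by
    intro i
    have h := (isProj_iff (hX i).convex _ _).1 (hx i).2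
    have e : xPart v i - xPart (0 : WVec n m d) i = xPart v i := sub_zero _
    simp only [e] at h
    refine ⟨h.1, fun z hz => ?_⟩
    convert h.2 z hz using 2
    abel
  have hy' : ∀ j, yPart v j ∈ P.Y j ∧ ∀ z ∈ P.Y j,
      ((P.B j)ᵀ *ᵥ lamPart v - yPart g j) ⬝ᵥ (z - yPart v j) ≤ 0 := by
    intro j
    have h := (isProj_iff (hY j).convex _ _).1 (hy j).2
    have e : yPart v j - yPart (0 : WVec n m d) j = yPart v j := sub_zero _
    simp only [e] at h
    refine ⟨h.1, fun z hz => ?_⟩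
    convert h.2 z hz using 2
    abel
  refine P.mem_solSet_of_multiplier ⟨fun i => (hx' i).1, fun j => (hy' j).1⟩ hr fun w hw => ?_
  have h1 := P.dotProduct_resid_sub (lamPart v) w v
  rw [hr, dotProduct_zero, sub_zero] at h1
  rw [← h1, obj, obj, add_sub_add_comm, ← Finset.sum_sub_distrib, ← Finset.sum_sub_distrib]
  refine add_le_add (Finset.sum_le_sum fun i _ => ?_) (Finset.sum_le_sum fun j _ => ?_)
  · have h2 := (hx' i).2 _ (hw.1 i)
    have h3 : P.f i (xPart v i) + xPart g i ⬝ᵥ (xPart w i - xPart v i)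
        ≤ P.f i (xPart w i) := (hx i).1 (xPart w i)
    rw [sub_dotProduct, dotProduct_comm ((P.A i)ᵀ *ᵥ lamPart v)] at h2
    linarith
  · have h2 := (hy' j).2 _ (hw.2 j)
    have h3 : P.g j (yPart v j) + yPart g j ⬝ᵥ (yPart w j - yPart v j)
        ≤ P.g j (yPart w j) := (hy j).1 (yPart w j)
    rw [sub_dotProduct, dotProduct_comm ((P.B j)ᵀ *ᵥ lamPart v)] at h2
    linarith

theorem exists_mem_errGraph {w e : WVec n m d} (he : e ∈ P.errMap w 1) :
    ∃ g : WVec n m d, (Sum.elim w g, e) ∈ P.errGraph := by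
  obtain ⟨hx, hy, hl⟩ := he
  choose ξ hξ zx hzx ex using hx
  choose ω hω zy hzy ey using hy
  refine ⟨ofBlocks ξ ω 0, fun i => ⟨hξ i, ?_⟩, fun j => ⟨hω j, ?_⟩, ?_⟩
  · have h := hzx i
    rw [one_smul] at h
    have e' : xPart w i - xPart e i = zx i := by rw [ex i, sub_sub_cancel]
    simp only [Sum.elim_inl, Sum.elim_inr, xPart_ofBlocks]
    rw [e']
    exact h
  · have h := hzy j
    rw [one_smul] at h
    have e' : yPart w j - yPart e j = zy j := by rw [ey j, sub_sub_cancel]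
    simp only [Sum.elim_inl, Sum.elim_inr, yPart_ofBlocks]
    rw [e']
    exact h
  · rw [one_smul] at hl
    exact hl

theorem errMap_nonempty (hf : ∀ i, ConvexOn ℝ Set.univ (P.f i))
    (hg : ∀ j, ConvexOn ℝ Set.univ (P.g j))
    (hX : ∀ i, IsPolyhedron (P.X i)) (hY : ∀ j, IsPolyhedron (P.Y j))
    (hne : P.feasW.Nonempty) (w : WVec n m d) : (P.errMap w 1).Nonempty := by
  obtain ⟨w₀, hx₀, hy₀⟩ := hne
  choose ξ hξ using fun i => subdiff_nonempty (hf i) (xPart w i)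
  choose ω hω using fun j => subdiff_nonempty (hg j) (yPart w j)
  choose zx hzx hzx' using fun i => exists_projection (hX i).isClosed (hX i).convex ⟨_, hx₀ i⟩
    (xPart w i - (1 : ℝ) • (ξ i - (P.A i)ᵀ *ᵥ lamPart w))
  choose zy hzy hzy' using fun j => exists_projection (hY j).isClosed (hY j).convex ⟨_, hy₀ j⟩
    (yPart w j - (1 : ℝ) • (ω j - (P.B j)ᵀ *ᵥ lamPart w))
  exact ⟨ofBlocks (fun i => xPart w i - zx i) (fun j => yPart w j - zy j)
      ((1 : ℝ) • P.resid (xPart w) (yPart w)),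
    fun i => ⟨ξ i, hξ i, zx i, (isProj_iff (hX i).convex _ _).2 ⟨hzx i, hzx' i⟩, rfl⟩,
    fun j => ⟨ω j, hω j, zy j, (isProj_iff (hY j).convex _ _).2 ⟨hzy j, hzy' j⟩, rfl⟩, rfl⟩

/-- The error bound: on every neighbourhood `{dist(·, ℳ*) ≤ R}` of the solution set the squared
distance to it is at most a constant times the squared norm of any residual vector. -/
theorem exists_error_bound (hX : ∀ i, IsPolyhedron (P.X i)) (hY : ∀ j, IsPolyhedron (P.Y j))
    (hfs : ∀ i, IsPiecewiseLinear (subdiff (P.f i)))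
    (hgs : ∀ j, IsPiecewiseLinear (subdiff (P.g j))) {R : ℝ} (hR : 0 < R) :
    ∃ C : ℝ, 0 < C ∧ ∀ v : WVec n m d, distSq 1 v P.solSet ≤ R ^ 2 →
      ∀ e ∈ P.errMap v 1, distSq 1 v P.solSet ≤ C * sqNorm e := by
  obtain ⟨ε, hε, C, hC, h⟩ := (P.isPL_errGraph hX hY hfs hgs).error_bound
  refine ⟨Fintype.card (WIdx n m d) * C ^ 2 + R ^ 2 / ε ^ 2, by positivity, fun v hv e he => ?_⟩
  have hen := norm_sq_le_sqNorm e
  have hcard : 0 ≤ (Fintype.card (WIdx n m d) : ℝ) * C ^ 2 := by positivity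
  have hRε : 0 ≤ R ^ 2 / ε ^ 2 := by positivity
  rcases le_total ‖e‖ ε with hle | hle
  · obtain ⟨g, hg⟩ := P.exists_mem_errGraph he
    obtain ⟨u, hu, hn⟩ := h _ _ hg hle
    have hmem := P.mem_solSet_of_errGraph hX hY hu
    have h1 : ‖v - fun a => u (Sum.inl a)‖ ≤ C * ‖e‖ := by
      refine le_trans ?_ hn
      rw [pi_norm_le_iff_of_nonneg (norm_nonneg _)]
      exact fun a => norm_le_pi_norm (Sum.elim v g - u) (Sum.inl a)
    have h2 := distSq_one_le hmem v
    have h3 := sqNorm_le_card_mul_norm_sq (v - fun a => u (Sum.inl a))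
    have h4 : ‖v - fun a => u (Sum.inl a)‖ ^ 2 ≤ C ^ 2 * ‖e‖ ^ 2 := by
      rw [← mul_pow]
      exact pow_le_pow_left₀ (norm_nonneg _) h1 2
    calc distSq 1 v P.solSet
        ≤ Fintype.card (WIdx n m d) * ‖v - fun a => u (Sum.inl a)‖ ^ 2 := h2.trans h3
      _ ≤ Fintype.card (WIdx n m d) * (C ^ 2 * ‖e‖ ^ 2) := by gcongr
      _ = (Fintype.card (WIdx n m d) * C ^ 2) * ‖e‖ ^ 2 := by ring
      _ ≤ (Fintype.card (WIdx n m d) * C ^ 2) * sqNorm e := by gcongr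
      _ ≤ _ := by nlinarith [mul_nonneg hRε (sqNorm_nonneg e)]
  · -- away from `e = 0` the bound `R` on the distance itself is enough
    have h1 : ε ^ 2 ≤ sqNorm e := (pow_le_pow_left₀ hε.le hle 2).trans hen
    have h2 : R ^ 2 ≤ R ^ 2 / ε ^ 2 * sqNorm e := by
      rw [div_mul_eq_mul_div, le_div_iff₀ (by positivity)]
      gcongr
    nlinarith [mul_nonneg hcard (sqNorm_nonneg e)]

end Problem

/-! ### The matrices of the method -/

theorem isHermitian_of_dotProduct_comm {ι : Type*} [Fintype ι] [DecidableEq ι] {S : Matrix ι ι ℝ}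
    (h : ∀ u v : ι → ℝ, u ⬝ᵥ (S *ᵥ v) = v ⬝ᵥ (S *ᵥ u)) : S.IsHermitian := by
  ext i j
  have := h (Pi.single j 1) (Pi.single i 1)
  simpa using this

namespace Problem

variable {n p q : ℕ} {m : Fin p → ℕ} {d : Fin q → ℕ} (P : Problem n m d) (a : Params)

/-- The images `Aᵢ xᵢ` of the `x`-blocks. -/
def imX (e : WVec n m d) (i : Fin p) : Fin n → ℝ := P.A i *ᵥ xPart e i

/-- The images `Bⱼ yⱼ` of the `y`-blocks. -/
def imY (e : WVec n m d) (j : Fin q) : Fin n → ℝ := P.B j *ᵥ yPart e j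

theorem calB_mulVec (e : WVec n m d) :
    P.calB *ᵥ (fun b : BIdx d => e (Sum.inr (Sum.inl b))) = ∑ j, P.imY e j := by
  ext r
  simp only [Matrix.mulVec, calB, dotProduct, Finset.sum_apply, imY, Fintype.sum_sigma]
  rfl

theorem wVec_eq_elim (e : WVec n m d) :
    e = Sum.elim (fun b => e (Sum.inl b)) (Sum.elim (fun b => e (Sum.inr (Sum.inl b)))
      (lamPart e)) := by
  ext (b | b | b) <;> rfl

theorem xPart_matQ_mulVec (e : WVec n m d) (i : Fin p) :
    xPart (P.matQ a *ᵥ e) i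
      = (P.A i)ᵀ *ᵥ (a.β • ((a.σ₁ + 1) • P.imX e i - ∑ l, P.imX e l)) := by
  conv_lhs => rw [wVec_eq_elim e, matQ, Matrix.fromBlocks_mulVec]
  ext r
  have h1 : ∀ v : BIdx m, P.matHx a ⟨i, r⟩ v = a.β * ((if i = v.1 then a.σ₁ + 1 else 0)
      * ((P.A i)ᵀ * P.A v.1) r v.2) - a.β * ((P.A i)ᵀ * P.A v.1) r v.2 := by
    intro v
    simp only [matHx, Matrix.of_apply]
    split_ifs <;> ring
  have h2 : ∀ l, ∑ x, ((P.A i)ᵀ * P.A l) r x * xPart e l x = ((P.A i)ᵀ *ᵥ P.imX e l) r := by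
    intro l
    rw [imX, Matrix.mulVec_mulVec]
    rfl
  have h3 : (P.matHx a *ᵥ fun b => e (Sum.inl b)) ⟨i, r⟩
      = a.β * ((a.σ₁ + 1) * ((P.A i)ᵀ *ᵥ P.imX e i) r)
        - a.β * ∑ l, ((P.A i)ᵀ *ᵥ P.imX e l) r := by
    simp only [Matrix.mulVec, dotProduct, h1, Fintype.sum_sigma, sub_mul, Finset.sum_sub_distrib]
    congr 1
    · rw [Finset.sum_eq_single i]
      · have := h2 i
        simp only [Matrix.mulVec, dotProduct] at this
        rw [← this]
        simp only [if_true, Finset.mul_sum, mul_assoc]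
        rfl
      · intro l _ hl
        simp [hl.symm]
      · simp
    · rw [Finset.mul_sum]
      refine Finset.sum_congr rfl fun l _ => ?_
      have := h2 l
      simp only [Matrix.mulVec, dotProduct] at this
      rw [← this]
      simp only [Finset.mul_sum, mul_assoc]
      rfl
  have h4 : ((P.A i)ᵀ *ᵥ ∑ l, P.imX e l) r = ∑ l, ((P.A i)ᵀ *ᵥ P.imX e l) r := by
    have := congrFun (map_sum (P.A i)ᵀ.mulVecLin (P.imX e) Finset.univ) r
    simpa only [Matrix.mulVecLin_apply, Finset.sum_apply] using this
  rw [Matrix.mulVec_smul, Matrix.mulVec_sub, Matrix.mulVec_smul]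
  simp only [Pi.smul_apply, Pi.sub_apply, smul_eq_mul, h4]
  simp only [xPart, Sum.elim_inl, Matrix.zero_mulVec, add_zero, Sum.elim_comp_inl]
  rw [h3]
  ring

theorem yPart_matQ_mulVec (e : WVec n m d) (j : Fin q) :
    yPart (P.matQ a *ᵥ e) j
      = (P.B j)ᵀ *ᵥ (((a.σ₂ + 1) * a.β) • P.imY e j - a.τ • lamPart e) := by
  conv_lhs => rw [wVec_eq_elim e, matQ, Matrix.fromBlocks_mulVec]
  ext r
  have h1 : ((Matrix.blockDiagonal' fun j => ((a.σ₂ + 1) * a.β) • ((P.B j)ᵀ * P.B j))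
      *ᵥ fun b : BIdx d => e (Sum.inr (Sum.inl b))) ⟨j, r⟩
      = (a.σ₂ + 1) * a.β * ((P.B j)ᵀ *ᵥ P.imY e j) r := by
    rw [imY, Matrix.mulVec_mulVec]
    simp only [Matrix.mulVec, dotProduct, Fintype.sum_sigma]
    rw [Finset.sum_eq_single j]
    · simp only [Matrix.blockDiagonal'_apply_eq, Matrix.smul_apply, smul_eq_mul, Finset.mul_sum,
        mul_assoc]
      rfl
    · intro l _ hl
      exact Finset.sum_eq_zero fun x _ => by
        rw [Matrix.blockDiagonal'_apply_ne _ _ _ hl.symm, zero_mul]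
    · simp
  have h2 : (P.calBᵀ *ᵥ lamPart e) ⟨j, r⟩ = ((P.B j)ᵀ *ᵥ lamPart e) r := rfl
  rw [Matrix.mulVec_sub, Matrix.mulVec_smul, Matrix.mulVec_smul]
  simp only [Pi.smul_apply, Pi.sub_apply, smul_eq_mul]
  simp only [yPart, Sum.elim_inr, Matrix.zero_mulVec, zero_add, Sum.elim_comp_inr,
    Matrix.fromBlocks_mulVec, Sum.elim_inl, Sum.elim_comp_inl, Pi.add_apply, Matrix.smul_mulVec,
    Pi.smul_apply, smul_eq_mul, h1, h2]
  ring

theorem lamPart_matQ_mulVec (e : WVec n m d) :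
    lamPart (P.matQ a *ᵥ e) = (1 / a.β) • lamPart e - ∑ j, P.imY e j := by
  conv_lhs => rw [wVec_eq_elim e, matQ, Matrix.fromBlocks_mulVec]
  ext r
  conv_lhs => simp only [lamPart, Sum.elim_inr, Matrix.zero_mulVec, zero_add, Sum.elim_comp_inr,
    Matrix.fromBlocks_mulVec, Sum.elim_inl, Sum.elim_comp_inl, Pi.add_apply, Matrix.smul_mulVec,
    Matrix.one_mulVec, Matrix.neg_mulVec, calB_mulVec]
  simp only [Pi.sub_apply, Pi.neg_apply, Pi.smul_apply]
  rw [neg_add_eq_sub]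

theorem matM_mulVec_eq (e : WVec n m d) :
    P.matM a *ᵥ e = ofBlocks (xPart e) (yPart e)
      ((a.τ + a.s) • lamPart e - (a.s * a.β) • ∑ j, P.imY e j) := by
  conv_lhs => rw [wVec_eq_elim e, matM, Matrix.fromBlocks_mulVec]
  simp only [Matrix.zero_mulVec, zero_add, add_zero, Sum.elim_comp_inr, Sum.elim_comp_inl,
    Matrix.fromBlocks_mulVec, Matrix.smul_mulVec, Matrix.one_mulVec, calB_mulVec]
  rw [neg_smul, neg_add_eq_sub]
  rfl

theorem dotProduct_matQ_mulVec (u e : WVec n m d) :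
    u ⬝ᵥ (P.matQ a *ᵥ e)
      = a.β * ((a.σ₁ + 1) * ∑ i, P.imX u i ⬝ᵥ P.imX e i
          - (∑ i, P.imX u i) ⬝ᵥ ∑ i, P.imX e i)
        + ((a.σ₂ + 1) * a.β * ∑ j, P.imY u j ⬝ᵥ P.imY e j
          - a.τ * ((∑ j, P.imY u j) ⬝ᵥ lamPart e))
        + (1 / a.β * (lamPart u ⬝ᵥ lamPart e) - lamPart u ⬝ᵥ ∑ j, P.imY e j) := by
  rw [dotProduct_wVec]
  simp only [xPart_matQ_mulVec, yPart_matQ_mulVec, lamPart_matQ_mulVec,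
    dotProduct_transpose_mulVec]
  congr 1
  · congr 1
    · rw [sum_dotProduct, Finset.mul_sum, ← Finset.sum_sub_distrib, Finset.mul_sum]
      refine Finset.sum_congr rfl fun i _ => ?_
      rw [dotProduct_comm]
      simp only [dotProduct_smul, dotProduct_sub, smul_eq_mul]
      rfl
    · rw [sum_dotProduct, Finset.mul_sum, Finset.mul_sum, ← Finset.sum_sub_distrib]
      refine Finset.sum_congr rfl fun j _ => ?_
      rw [dotProduct_comm]
      simp only [dotProduct_smul, dotProduct_sub, smul_eq_mul]
      rfl
  · simp only [dotProduct_smul, dotProduct_sub, smul_eq_mul]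

theorem matM_dotProduct_matQ_mulVec (u e : WVec n m d) :
    (P.matM a *ᵥ u) ⬝ᵥ (P.matQ a *ᵥ e)
      = a.β * ((a.σ₁ + 1) * ∑ i, P.imX u i ⬝ᵥ P.imX e i
          - (∑ i, P.imX u i) ⬝ᵥ ∑ i, P.imX e i)
        + ((a.σ₂ + 1) * a.β * ∑ j, P.imY u j ⬝ᵥ P.imY e j
          - a.τ * ((∑ j, P.imY u j) ⬝ᵥ lamPart e))
        + ((a.τ + a.s) * (1 / a.β * (lamPart u ⬝ᵥ lamPart e) - lamPart u ⬝ᵥ ∑ j, P.imY e j)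
          - (a.s * a.β) * (1 / a.β * ((∑ j, P.imY u j) ⬝ᵥ lamPart e)
            - (∑ j, P.imY u j) ⬝ᵥ ∑ j, P.imY e j)) := by
  have hx : P.imX (P.matM a *ᵥ u) = P.imX u := by
    rw [matM_mulVec_eq]
    rfl
  have hy : P.imY (P.matM a *ᵥ u) = P.imY u := by
    rw [matM_mulVec_eq]
    rfl
  have hl : lamPart (P.matM a *ᵥ u)
      = (a.τ + a.s) • lamPart u - (a.s * a.β) • ∑ j, P.imY u j := by
    rw [matM_mulVec_eq]
    rfl
  rw [dotProduct_matQ_mulVec, hx, hy, hl]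
  simp only [sub_dotProduct, smul_dotProduct, smul_eq_mul]
  ring

variable {a}

theorem matM_isUnit_det (ha : a.Admissible p q) : IsUnit (P.matM a).det := by
  rw [matM, Matrix.det_fromBlocks_zero₁₂, Matrix.det_fromBlocks_zero₁₂, Matrix.det_one,
    Matrix.det_one, Matrix.det_smul, Matrix.det_one]
  have : a.τ + a.s ≠ 0 := ha.2.2.2.2.2.ne'
  simp [this]

theorem matH_mulVec_matM_mulVec (ha : a.Admissible p q) (e : WVec n m d) :
    P.matH a *ᵥ (P.matM a *ᵥ e) = P.matQ a *ᵥ e := by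
  rw [Matrix.mulVec_mulVec, matH, Matrix.mul_assoc,
    Matrix.nonsing_inv_mul _ (P.matM_isUnit_det ha), Matrix.mul_one]

theorem exists_matM_mulVec (ha : a.Admissible p q) (v : WVec n m d) :
    ∃ e, P.matM a *ᵥ e = v :=
  ⟨(P.matM a)⁻¹ *ᵥ v, by
    rw [Matrix.mulVec_mulVec, Matrix.mul_nonsing_inv _ (P.matM_isUnit_det ha), Matrix.one_mulVec]⟩

theorem matM_dotProduct_matQ_comm (ha : a.Admissible p q) (u e : WVec n m d) :
    (P.matM a *ᵥ u) ⬝ᵥ (P.matQ a *ᵥ e) = (P.matM a *ᵥ e) ⬝ᵥ (P.matQ a *ᵥ u) := by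
  have hβ : a.β ≠ 0 := ha.1.ne'
  rw [matM_dotProduct_matQ_mulVec, matM_dotProduct_matQ_mulVec]
  simp only [dotProduct_comm (P.imX u _), dotProduct_comm (P.imY u _),
    dotProduct_comm (∑ i, P.imX u i), dotProduct_comm (∑ j, P.imY u j),
    dotProduct_comm (lamPart u)]
  field_simp
  ring

theorem matH_isHermitian (ha : a.Admissible p q) : (P.matH a).IsHermitian := by
  refine isHermitian_of_dotProduct_comm fun u v => ?_
  obtain ⟨u, rfl⟩ := P.exists_matM_mulVec ha u
  obtain ⟨v, rfl⟩ := P.exists_matM_mulVec ha v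
  rw [P.matH_mulVec_matM_mulVec ha, P.matH_mulVec_matM_mulVec ha, P.matM_dotProduct_matQ_comm ha]

theorem dotProduct_matG_mulVec (u v : WVec n m d) :
    u ⬝ᵥ (P.matG a *ᵥ v) = u ⬝ᵥ (P.matQ a *ᵥ v) + v ⬝ᵥ (P.matQ a *ᵥ u)
      - (P.matM a *ᵥ u) ⬝ᵥ (P.matQ a *ᵥ v) := by
  rw [matG, Matrix.sub_mulVec, Matrix.add_mulVec, dotProduct_sub, dotProduct_add,
    dotProduct_transpose_mulVec, ← Matrix.mulVec_mulVec, dotProduct_transpose_mulVec,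
    dotProduct_comm (P.matQ a *ᵥ v)]

theorem matG_isHermitian (ha : a.Admissible p q) : (P.matG a).IsHermitian := by
  refine isHermitian_of_dotProduct_comm fun u v => ?_
  rw [dotProduct_matG_mulVec, dotProduct_matG_mulVec, P.matM_dotProduct_matQ_comm ha u v]
  ring

/-- The quadratic forms of `Mᵀ Q` and of `G` both become, after completing the square in the
multiplier, of the form below with `κ ≤ 1`; since `‖∑ Aᵢxᵢ‖² ≤ p ∑ ‖Aᵢxᵢ‖²`, and likewise for `y`,
such a form is positive definite. -/
theorem quadratic_form_pos (ha : a.Admissible p q)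
    (hA : ∀ i, (P.A i).rank = m i) (hB : ∀ j, (P.B j).rank = d j)
    {κ γ : ℝ} (ρ : ℝ) (hκ : κ ≤ 1) (hγ : 0 < γ) {e : WVec n m d} (he : e ≠ 0) :
    0 < a.β * ((a.σ₁ + 1) * ∑ i, sqNorm (P.imX e i) - sqNorm (∑ i, P.imX e i))
      + a.β * ((a.σ₂ + 1) * ∑ j, sqNorm (P.imY e j) - κ * sqNorm (∑ j, P.imY e j))
      + γ * sqNorm (lamPart e + ρ • ∑ j, P.imY e j) := by
  obtain ⟨hβ, hσ₁, hσ₂, -, -, -⟩ := ha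
  set SA := ∑ i, sqNorm (P.imX e i)
  set SB := ∑ j, sqNorm (P.imY e j)
  have hSA : 0 ≤ SA := Finset.sum_nonneg fun i _ => sqNorm_nonneg _
  have hSB : 0 ≤ SB := Finset.sum_nonneg fun i _ => sqNorm_nonneg _
  have h1 := sqNorm_sum_le (P.imX e)
  have h2 := sqNorm_sum_le (P.imY e)
  rw [Fintype.card_fin] at h1 h2
  have hl := mul_nonneg hγ.le (sqNorm_nonneg (lamPart e + ρ • ∑ j, P.imY e j))
  have h3 : (a.σ₁ + 1 - p) * SA ≤ (a.σ₁ + 1) * SA - sqNorm (∑ i, P.imX e i) := by linarith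
  have h4 : (a.σ₂ + 1 - q) * SB ≤ (a.σ₂ + 1) * SB - κ * sqNorm (∑ j, P.imY e j) := by
    nlinarith [sqNorm_nonneg (∑ j, P.imY e j)]
  have h5 : 0 ≤ (a.σ₁ + 1 - p) * SA := mul_nonneg (by linarith) hSA
  have h6 : 0 ≤ (a.σ₂ + 1 - q) * SB := mul_nonneg (by linarith) hSB
  have h7 := mul_le_mul_of_nonneg_left h3 hβ.le
  have h8 := mul_le_mul_of_nonneg_left h4 hβ.le
  have h9 := mul_nonneg hβ.le h5
  have h10 := mul_nonneg hβ.le h6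
  by_contra hle
  push Not at hle
  -- all three terms vanish, hence all blocks of `e`
  have hA0 : a.β * ((a.σ₁ + 1 - p) * SA) = 0 := by linarith
  have hB0 : a.β * ((a.σ₂ + 1 - q) * SB) = 0 := by linarith
  have hl0 : γ * sqNorm (lamPart e + ρ • ∑ j, P.imY e j) = 0 := by linarith
  have hSA0 : SA = 0 := by
    have : a.σ₁ + 1 - p ≠ 0 := by linarith
    simpa [hβ.ne', this] using hA0
  have hSB0 : SB = 0 := by
    have : a.σ₂ + 1 - q ≠ 0 := by linarith
    simpa [hβ.ne', this] using hB0
  have hx : ∀ i, xPart e i = 0 := by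
    intro i
    have h := (Finset.sum_eq_zero_iff_of_nonneg (fun i _ => sqNorm_nonneg _)).1 hSA0 i
      (Finset.mem_univ i)
    exact mulVec_eq_zero_of_rank (P.A i) (by simpa using hA i) (sqNorm_eq_zero.1 h)
  have hy' : ∀ j, P.imY e j = 0 := fun j => sqNorm_eq_zero.1
    ((Finset.sum_eq_zero_iff_of_nonneg (fun i _ => sqNorm_nonneg _)).1 hSB0 j (Finset.mem_univ j))
  have hy : ∀ j, yPart e j = 0 := fun j =>
    mulVec_eq_zero_of_rank (P.B j) (by simpa using hB j) (hy' j)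
  have hlam : lamPart e = 0 := by
    have h := (mul_eq_zero.1 hl0).resolve_left hγ.ne'
    simpa [hy', sqNorm_eq_zero] using h
  apply he
  ext (⟨i, r⟩ | ⟨j, r⟩ | r)
  · exact congrFun (hx i) r
  · exact congrFun (hy j) r
  · exact congrFun hlam r

theorem matH_posDef (ha : a.Admissible p q)
    (hA : ∀ i, (P.A i).rank = m i) (hB : ∀ j, (P.B j).rank = d j) : (P.matH a).PosDef := by
  refine Matrix.PosDef.of_dotProduct_mulVec_pos (P.matH_isHermitian ha) fun v hv => ?_
  obtain ⟨e, rfl⟩ := P.exists_matM_mulVec ha v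
  have he : e ≠ 0 := by
    rintro rfl
    exact hv (Matrix.mulVec_zero _)
  rw [star_trivial, P.matH_mulVec_matM_mulVec ha, matM_dotProduct_matQ_mulVec]
  have hβ := ha.1
  have h := P.quadratic_form_pos ha hA hB (κ := a.τ) (γ := (a.τ + a.s) / a.β) (-a.β)
    ha.2.2.2.1.le (div_pos ha.2.2.2.2.2 hβ) he
  refine h.trans_eq ?_
  rw [sqNorm_add, sqNorm_smul, dotProduct_smul, smul_eq_mul]
  simp only [sqNorm, dotProduct_comm (∑ j, P.imY e j) (lamPart e)]
  field_simp
  ring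

theorem matG_posDef (ha : a.Admissible p q)
    (hA : ∀ i, (P.A i).rank = m i) (hB : ∀ j, (P.B j).rank = d j) : (P.matG a).PosDef := by
  refine Matrix.PosDef.of_dotProduct_mulVec_pos (P.matG_isHermitian ha) fun e he => ?_
  rw [star_trivial, dotProduct_matG_mulVec, matM_dotProduct_matQ_mulVec, dotProduct_matQ_mulVec]
  have hβ := ha.1
  have hτ := ha.2.2.2.1
  have hs := ha.2.2.2.2.1
  have hc : 0 < 2 - a.τ - a.s := by linarith
  -- the Schur complement in the multiplier; `κ ≤ 1` because `1 - s ≤ 2 - τ - s`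
  have hκ : a.s + (a.s - 1) ^ 2 / (2 - a.τ - a.s) ≤ 1 := by
    have : (a.s - 1) ^ 2 / (2 - a.τ - a.s) ≤ 1 - a.s := by
      rw [div_le_iff₀ hc]
      nlinarith
    linarith
  have h := P.quadratic_form_pos ha hA hB (γ := (2 - a.τ - a.s) / a.β)
    ((a.s - 1) * a.β / (2 - a.τ - a.s)) hκ (div_pos hc hβ) he
  refine h.trans_eq ?_
  rw [sqNorm_add, sqNorm_smul, dotProduct_smul, smul_eq_mul]
  simp only [sqNorm, dotProduct_comm (∑ j, P.imY e j) (lamPart e)]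
  field_simp
  ring

end Problem

/-! ### Optimality conditions of one iteration -/

section prox

variable {ι κ : Type*} [Fintype ι] [Fintype κ]

/-- First-order optimality of a minimiser of `f + φ` over a convex set, where `f` is convex and `φ`
is quadratic with gradient `g` at the minimiser. -/
theorem variational_of_isMinOn {f φ : (κ → ℝ) → ℝ} (hf : ConvexOn ℝ Set.univ f)
    {X : Set (κ → ℝ)} (hX : Convex ℝ X) {x₀ : κ → ℝ} (hx₀ : x₀ ∈ X)
    (hmin : IsMinOn (fun z => f z + φ z) X x₀) (g : κ → ℝ) (K : (κ → ℝ) → ℝ)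
    (hφ : ∀ (v : κ → ℝ) (t : ℝ), φ (x₀ + t • v) = φ x₀ + t * (g ⬝ᵥ v) + t ^ 2 * K v)
    {z : κ → ℝ} (hz : z ∈ X) : 0 ≤ f z - f x₀ + g ⬝ᵥ (z - x₀) := by
  set D := f z - f x₀ + g ⬝ᵥ (z - x₀) with hD
  have key : ∀ t : ℝ, t ∈ Set.Ioc (0 : ℝ) 1 → 0 ≤ D + t * K (z - x₀) := by
    rintro t ⟨h0, h1⟩
    have hmem : x₀ + t • (z - x₀) ∈ X := hX.add_smul_sub_mem hx₀ hz ⟨h0.le, h1⟩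
    have h2 : f x₀ + φ x₀ ≤ f (x₀ + t • (z - x₀)) + φ (x₀ + t • (z - x₀)) := hmin hmem
    have h3 := hf.2 (Set.mem_univ x₀) (Set.mem_univ z) (sub_nonneg.2 h1) h0.le (by ring)
    have e : (1 - t) • x₀ + t • z = x₀ + t • (z - x₀) := by
      rw [sub_smul, one_smul, smul_sub]
      abel
    rw [e, smul_eq_mul, smul_eq_mul] at h3
    rw [hφ] at h2
    have h4 : t * 0 ≤ t * (D + t * K (z - x₀)) := by
      rw [hD]
      nlinarith
    exact le_of_mul_le_mul_left h4 h0
  have hlim : Filter.Tendsto (fun t : ℝ => D + t * K (z - x₀)) (nhdsWithin 0 (Set.Ioi 0))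
      (nhds (D + 0 * K (z - x₀))) := by
    refine Filter.Tendsto.mono_left ?_ nhdsWithin_le_nhds
    apply Continuous.tendsto
    fun_prop
  rw [zero_mul, add_zero] at hlim
  refine ge_of_tendsto hlim ?_
  filter_upwards [Ioc_mem_nhdsGT one_pos] with t ht using key t ht

/-- The optimality condition of a proximal augmented Lagrangian subproblem. -/
theorem variational_of_prox {f : (κ → ℝ) → ℝ} (hf : ConvexOn ℝ Set.univ f)
    {X : Set (κ → ℝ)} (hX : Convex ℝ X) {x x₀ : κ → ℝ} (hx₀ : x₀ ∈ X)
    (A : Matrix ι κ ℝ) (l r : ι → ℝ) (β σ C : ℝ)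
    (hmin : IsMinOn (fun z => f z + (C - l ⬝ᵥ (r + A *ᵥ (z - x))
      + β / 2 * sqNorm (r + A *ᵥ (z - x)) + σ / 2 * sqNorm (A *ᵥ (z - x)))) X x₀)
    {z : κ → ℝ} (hz : z ∈ X) :
    0 ≤ f z - f x₀ + (Aᵀ *ᵥ (-l + β • (r + A *ᵥ (x₀ - x)) + σ • (A *ᵥ (x₀ - x)))) ⬝ᵥ (z - x₀) := by
  refine variational_of_isMinOn hf hX hx₀ hmin _
    (fun v => (β + σ) / 2 * sqNorm (A *ᵥ v)) (fun v t => ?_) hz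
  have e : x₀ + t • v - x = (x₀ - x) + t • v := by abel
  rw [e, Matrix.mulVec_add, Matrix.mulVec_smul, ← add_assoc, sqNorm_add, sqNorm_add, sqNorm_add,
    sqNorm_smul,
    dotProduct_comm (Aᵀ *ᵥ _), dotProduct_transpose_mulVec]
  simp only [dotProduct_add, add_dotProduct, dotProduct_smul, smul_dotProduct, neg_dotProduct,
    smul_eq_mul]
  ring

end prox

theorem sum_update {ι M : Type*} [Fintype ι] [DecidableEq ι] [AddCommGroup M] {α : ι → Type*}
    (F : ∀ i, α i → M) (x : ∀ i, α i) (i : ι) (z : α i) :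
    ∑ l, F l (Function.update x i z l) = ∑ l, F l (x l) + (F i z - F i (x i)) := by
  rw [← sub_eq_iff_eq_add', ← Finset.sum_sub_distrib, Finset.sum_eq_single i]
  · simp
  · intro l _ hl
    simp [Function.update_of_ne hl]
  · simp

namespace Problem

variable {n p q : ℕ} {m : Fin p → ℕ} {d : Fin q → ℕ} (P : Problem n m d) {a : Params}

theorem resid_update_left (x : ∀ i, Fin (m i) → ℝ) (y : ∀ j, Fin (d j) → ℝ) (i : Fin p)
    (z : Fin (m i) → ℝ) :
    P.resid (Function.update x i z) y = P.resid x y + P.A i *ᵥ (z - x i) := by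
  rw [resid, resid, sum_update (fun i z => P.A i *ᵥ z), Matrix.mulVec_sub]
  abel

theorem resid_update_right (x : ∀ i, Fin (m i) → ℝ) (y : ∀ j, Fin (d j) → ℝ) (j : Fin q)
    (z : Fin (d j) → ℝ) :
    P.resid x (Function.update y j z) = P.resid x y + P.B j *ᵥ (z - y j) := by
  rw [resid, resid, sum_update (fun j z => P.B j *ᵥ z), Matrix.mulVec_sub]
  abel

/-- The predictor `w̃ = (x^{k+1}, y^{k+1}, lam^k - β (𝒜 x^{k+1} + ℬ y^k - c))` of an iteration from
`w = w^k` to `w' = w^{k+1}`. -/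
def predictor (a : Params) (w w' : WVec n m d) : WVec n m d :=
  ofBlocks (xPart w') (yPart w') (lamPart w - a.β • P.resid (xPart w') (yPart w))

theorem imX_sub_predictor (w w' : WVec n m d) (i : Fin p) :
    P.imX (w - P.predictor a w w') i = -(P.A i *ᵥ (xPart w' i - xPart w i)) := by
  rw [← Matrix.mulVec_neg, neg_sub]
  rfl

theorem imY_sub_predictor (w w' : WVec n m d) (j : Fin q) :
    P.imY (w - P.predictor a w w') j = -(P.B j *ᵥ (yPart w' j - yPart w j)) := by
  rw [← Matrix.mulVec_neg, neg_sub]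
  rfl

theorem lamPart_sub_predictor (w w' : WVec n m d) :
    lamPart (w - P.predictor a w w') = a.β • P.resid (xPart w') (yPart w) :=
  sub_sub_cancel _ _

theorem resid_left_eq (w w' : WVec n m d) :
    P.resid (xPart w') (yPart w)
      = P.resid (xPart w) (yPart w) - ∑ i, P.imX (w - P.predictor a w w') i := by
  simp only [imX_sub_predictor, resid, Matrix.mulVec_sub, Finset.sum_neg_distrib,
    Finset.sum_sub_distrib]
  abel

theorem resid_right_eq (w w' : WVec n m d) :
    P.resid (xPart w') (yPart w')
      = P.resid (xPart w') (yPart w) - ∑ j, P.imY (w - P.predictor a w w') j := by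
  simp only [imY_sub_predictor, resid, Matrix.mulVec_sub, Finset.sum_neg_distrib,
    Finset.sum_sub_distrib]
  abel

theorem lamPart_matQ_mulVec_sub_predictor (hβ : a.β ≠ 0) (w w' : WVec n m d) :
    lamPart (P.matQ a *ᵥ (w - P.predictor a w w')) = P.resid (xPart w') (yPart w') := by
  rw [lamPart_matQ_mulVec, lamPart_sub_predictor, smul_smul, one_div_mul_cancel hβ, one_smul,
    ← resid_right_eq]

/-- The optimality condition of the `xᵢ`-subproblem, in terms of the predictor. -/
theorem IsStep.variational_x {w w' : WVec n m d} (hs : P.IsStep a w w') {i : Fin p}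
    (hf : ConvexOn ℝ Set.univ (P.f i)) (hX : Convex ℝ (P.X i)) {z : Fin (m i) → ℝ}
    (hz : z ∈ P.X i) :
    0 ≤ P.f i z - P.f i (xPart w' i) + (-((P.A i)ᵀ *ᵥ lamPart (P.predictor a w w')
      + xPart (P.matQ a *ᵥ (w - P.predictor a w w')) i)) ⬝ᵥ (z - xPart w' i) := by
  obtain ⟨hmem, hmin⟩ := hs.1 i
  have h := variational_of_prox hf hX hmem (P.A i) (lamPart w) (P.resid (xPart w) (yPart w))
    a.β (a.σ₁ * a.β) (P.obj (xPart w) (yPart w) - P.f i (xPart w i)) (x := xPart w i) (by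
      convert hmin using 2 with v
      rw [augLag, resid_update_left, obj, obj, sum_update P.f]
      ring) hz
  convert h using 3
  rw [xPart_matQ_mulVec, ← Matrix.mulVec_add, ← Matrix.mulVec_neg]
  congr 1
  have e1 : lamPart (P.predictor a w w') = lamPart w - a.β • P.resid (xPart w') (yPart w) := rfl
  have e2 := P.imX_sub_predictor (a := a) w w' i
  rw [e1, P.resid_left_eq (a := a) w w', ← neg_eq_iff_eq_neg.2 e2]
  module

/-- The optimality condition of the `yⱼ`-subproblem, in terms of the predictor. -/
theorem IsStep.variational_y {w w' : WVec n m d} (hs : P.IsStep a w w') {j : Fin q}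
    (hg : ConvexOn ℝ Set.univ (P.g j)) (hY : Convex ℝ (P.Y j)) {z : Fin (d j) → ℝ}
    (hz : z ∈ P.Y j) :
    0 ≤ P.g j z - P.g j (yPart w' j) + (-((P.B j)ᵀ *ᵥ lamPart (P.predictor a w w')
      + yPart (P.matQ a *ᵥ (w - P.predictor a w w')) j)) ⬝ᵥ (z - yPart w' j) := by
  obtain ⟨hmem, hmin⟩ := hs.2.1 j
  have h := variational_of_prox hg hY hmem (P.B j) (P.lamHalf a w w')
    (P.resid (xPart w') (yPart w))
    a.β (a.σ₂ * a.β) (P.obj (xPart w') (yPart w) - P.g j (yPart w j)) (x := yPart w j) (by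
      convert hmin using 2 with v
      rw [augLag, resid_update_right, obj, obj, sum_update P.g]
      ring) hz
  convert h using 3
  rw [yPart_matQ_mulVec, ← Matrix.mulVec_add, ← Matrix.mulVec_neg]
  congr 1
  have e1 : lamPart (P.predictor a w w') = lamPart w - a.β • P.resid (xPart w') (yPart w) := rfl
  have e2 := P.imY_sub_predictor (a := a) w w' j
  rw [e1, lamHalf, lamPart_sub_predictor, ← neg_eq_iff_eq_neg.2 e2]
  module

/-- The corrector: `w^{k+1} = w^k - M (w^k - w̃)`. -/
theorem IsStep.corrector {w w' : WVec n m d} (hs : P.IsStep a w w') :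
    w' = w - P.matM a *ᵥ (w - P.predictor a w w') := by
  have hl : lamPart w' = lamPart (w - P.matM a *ᵥ (w - P.predictor a w w')) := by
    rw [hs.2.2, lamPart_sub, matM_mulVec_eq, lamPart_ofBlocks, lamPart_sub_predictor, lamHalf,
      P.resid_right_eq (a := a) w w']
    module
  ext (⟨i, r⟩ | ⟨j, r⟩ | r)
  · rw [matM_mulVec_eq]
    exact (sub_sub_cancel (w (Sum.inl ⟨i, r⟩)) (w' (Sum.inl ⟨i, r⟩))).symm
  · rw [matM_mulVec_eq]
    exact (sub_sub_cancel (w (Sum.inr (Sum.inl ⟨j, r⟩))) (w' (Sum.inr (Sum.inl ⟨j, r⟩)))).symm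
  · exact congrFun hl r

theorem IsStep.mem_feasW {w w' : WVec n m d} (hs : P.IsStep a w w') : w' ∈ P.feasW :=
  ⟨fun i => (hs.1 i).1, fun j => (hs.2.1 j).1⟩

/-- The predictor inequality: the optimality conditions of all subproblems, tested with a solution,
together with the variational inequality of the solution, tested with the predictor. -/
theorem IsStep.predictor_inequality (hβ : a.β ≠ 0) (hf : ∀ i, ConvexOn ℝ Set.univ (P.f i))
    (hg : ∀ j, ConvexOn ℝ Set.univ (P.g j)) (hX : ∀ i, Convex ℝ (P.X i))
    (hY : ∀ j, Convex ℝ (P.Y j)) {w w' v : WVec n m d} (hs : P.IsStep a w w')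
    (hv : v ∈ P.solSet) :
    0 ≤ (P.predictor a w w' - v) ⬝ᵥ (P.matQ a *ᵥ (w - P.predictor a w w')) := by
  set u := P.predictor a w w' with hu
  have huF : u ∈ P.feasW := hs.mem_feasW
  have h1 := hv.2 u huF
  rw [sub_dotProduct_J_self] at h1
  have h2 := Finset.sum_nonneg fun i (_ : i ∈ Finset.univ) =>
    hs.variational_x P (hf i) (hX i) (hv.1.1 i)
  have h3 := Finset.sum_nonneg fun j (_ : j ∈ Finset.univ) =>
    hs.variational_y P (hg j) (hY j) (hv.1.2 j)
  have h4 := P.dotProduct_resid_sub (lamPart u) v u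
  have h5 := P.lamPart_matQ_mulVec_sub_predictor hβ w w'
  have ex : ∀ i, xPart w' i = xPart u i := fun i => rfl
  have ey : ∀ j, yPart w' j = yPart u j := fun j => rfl
  have er : P.resid (xPart w') (yPart w') = P.resid (xPart u) (yPart u) := rfl
  rw [er, ← hu] at h5
  have h6 : (u - v) ⬝ᵥ (P.matQ a *ᵥ (w - u)) = -((v - u) ⬝ᵥ (P.matQ a *ᵥ (w - u))) := by
    rw [← neg_dotProduct, neg_sub]
  rw [h6, dotProduct_wVec, h5]
  simp only [← hu, ex, ey, neg_dotProduct, add_dotProduct, Finset.sum_add_distrib,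
    Finset.sum_sub_distrib, Finset.sum_neg_distrib] at h2 h3
  simp only [dotProduct_comm _ (xPart v _ - xPart u _)] at h2
  simp only [dotProduct_comm _ (yPart v _ - yPart u _)] at h3
  simp only [obj] at h1
  simp only [xPart_sub, yPart_sub, lamPart_sub, sub_dotProduct (lamPart v)]
  linarith

/-- Strict contraction: in the `H`-norm the iteration approaches every solution, with a decrease
controlled by the `G`-norm of `w^k - w̃`. -/
theorem IsStep.contraction (ha : a.Admissible p q) (hf : ∀ i, ConvexOn ℝ Set.univ (P.f i))
    (hg : ∀ j, ConvexOn ℝ Set.univ (P.g j)) (hX : ∀ i, Convex ℝ (P.X i))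
    (hY : ∀ j, Convex ℝ (P.Y j)) {w w' v : WVec n m d} (hs : P.IsStep a w w')
    (hv : v ∈ P.solSet) :
    sqNormW (P.matH a) (w' - v) + sqNormW (P.matG a) (w - P.predictor a w w')
      ≤ sqNormW (P.matH a) (w - v) := by
  have h1 := hs.predictor_inequality P ha.1.ne' hf hg hX hY hv
  have hw := hs.corrector P
  generalize P.predictor a w w' = u at *
  obtain ⟨e, he⟩ : ∃ e, w - u = e := ⟨_, rfl⟩
  rw [he] at h1 hw ⊢
  have hsym : ∀ y z, y ⬝ᵥ (P.matH a *ᵥ z) = z ⬝ᵥ (P.matH a *ᵥ y) := by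
    intro y z
    obtain ⟨y, rfl⟩ := P.exists_matM_mulVec ha y
    obtain ⟨z, rfl⟩ := P.exists_matM_mulVec ha z
    rw [P.matH_mulVec_matM_mulVec ha, P.matH_mulVec_matM_mulVec ha, P.matM_dotProduct_matQ_comm ha]
  have e1 : w' - v = (w - v) - P.matM a *ᵥ e := by
    rw [hw]
    abel
  have e2 : u - v = (w - v) - e := by
    rw [← he]
    abel
  rw [e2, sub_dotProduct] at h1
  have h2 : sqNormW (P.matH a) (w' - v) = sqNormW (P.matH a) (w - v)
      - 2 * ((w - v) ⬝ᵥ (P.matQ a *ᵥ e)) + (P.matM a *ᵥ e) ⬝ᵥ (P.matQ a *ᵥ e) := by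
    rw [e1, sqNormW, sqNormW, Matrix.mulVec_sub, sub_dotProduct, dotProduct_sub, dotProduct_sub,
      hsym (P.matM a *ᵥ e) (w - v), P.matH_mulVec_matM_mulVec ha]
    ring
  have h3 := P.dotProduct_matG_mulVec (a := a) e e
  rw [h2, sqNormW, sqNormW, h3]
  linarith

end Problem

namespace Problem

variable {n p q : ℕ} {m : Fin p → ℕ} {d : Fin q → ℕ} (P : Problem n m d) {a : Params}

/-! ### The residual of the new iterate -/

theorem IsStep.lamPart_sub_predictor_eq {w w' : WVec n m d} (hs : P.IsStep a w w') :
    lamPart w' - lamPart (P.predictor a w w')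
      = (1 - a.τ - a.s) • lamPart (w - P.predictor a w w')
        + (a.s * a.β) • ∑ j, P.imY (w - P.predictor a w w') j := by
  have h := congrArg lamPart (hs.corrector P)
  rw [lamPart_sub, matM_mulVec_eq, lamPart_ofBlocks] at h
  rw [h, lamPart_sub]
  module

/-- A residual vector at the new iterate whose blocks are bounded by the change of the iterates. -/
theorem IsStep.exists_mem_errMap (hβ : a.β ≠ 0) (hf : ∀ i, ConvexOn ℝ Set.univ (P.f i))
    (hg : ∀ j, ConvexOn ℝ Set.univ (P.g j)) (hX : ∀ i, IsPolyhedron (P.X i))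
    (hY : ∀ j, IsPolyhedron (P.Y j)) {w w' e : WVec n m d} (hs : P.IsStep a w w')
    (he : w - P.predictor a w w' = e) :
    ∃ r ∈ P.errMap w' 1,
      (∀ i, sqNorm (xPart r i) ≤ P.mu i * sqNorm ((a.β * (a.σ₁ - 1)) • P.imX e i
        + a.β • ((2 : ℝ) • P.imX e i - ∑ l, P.imX e l)
        + ((a.τ + a.s - 1) • lamPart e + (-(a.s * a.β)) • ∑ j, P.imY e j))) ∧
      (∀ j, sqNorm (yPart r j) ≤ P.nu j * sqNorm (((a.σ₂ + 1) * a.β) • P.imY e j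
        + (a.s - 1) • lamPart e + (-(a.s * a.β)) • ∑ j, P.imY e j)) ∧
      lamPart r = (1 / a.β) • lamPart e - ∑ j, P.imY e j := by
  have hlam := hs.lamPart_sub_predictor_eq P
  have hres := P.lamPart_matQ_mulVec_sub_predictor hβ w w'
  have hvx := fun i (z : Fin (m i) → ℝ) hz =>
    hs.variational_x P (i := i) (z := z) (hf i) (hX i).convex hz
  have hvy := fun j (z : Fin (d j) → ℝ) hz =>
    hs.variational_y P (j := j) (z := z) (hg j) (hY j).convex hz
  rw [he] at hlam hres
  simp only [he] at hvx hvy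
  have hxm : ∀ i, xPart w' i ∈ P.X i := fun i => (hs.1 i).1
  have hym : ∀ j, yPart w' j ∈ P.Y j := fun j => (hs.2.1 j).1
  choose ξ hξ hξ' using fun i => exists_subgradient (hf i) (hX i).convex (hxm i) _ (hvx i)
  choose ω hω hω' using fun j => exists_subgradient (hg j) (hY j).convex (hym j) _ (hvy j)
  choose zx hzx hzx' using fun i => exists_projection (hX i).isClosed (hX i).convex ⟨_, hxm i⟩
    (xPart w' i - (1 : ℝ) • (ξ i - (P.A i)ᵀ *ᵥ lamPart w'))
  choose zy hzy hzy' using fun j => exists_projection (hY j).isClosed (hY j).convex ⟨_, hym j⟩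
    (yPart w' j - (1 : ℝ) • (ω j - (P.B j)ᵀ *ᵥ lamPart w'))
  refine ⟨ofBlocks (fun i => xPart w' i - zx i) (fun j => yPart w' j - zy j)
      ((1 : ℝ) • P.resid (xPart w') (yPart w')), ⟨
    fun i => ⟨ξ i, hξ i, zx i, (isProj_iff (hX i).convex _ _).2 ⟨hzx i, hzx' i⟩, rfl⟩,
    fun j => ⟨ω j, hω j, zy j, (isProj_iff (hY j).convex _ _).2 ⟨hzy j, hzy' j⟩, rfl⟩, rfl⟩,
    fun i => ?_, fun j => ?_, ?_⟩
  · refine (sqNorm_sub_projection_le (hxm i) (hzx i) (hξ' i) (hzx' i)).trans ?_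
    refine le_trans (le_of_eq ?_) (sqNorm_transpose_mulVec_le (P.A i) _)
    congr 1
    rw [xPart_matQ_mulVec, one_smul]
    have e1 : ξ i - (P.A i)ᵀ *ᵥ lamPart w'
        - (ξ i + -((P.A i)ᵀ *ᵥ lamPart (P.predictor a w w')
          + (P.A i)ᵀ *ᵥ (a.β • ((a.σ₁ + 1) • P.imX e i - ∑ l, P.imX e l))))
        = (P.A i)ᵀ *ᵥ ((a.β • ((a.σ₁ + 1) • P.imX e i - ∑ l, P.imX e l))
          - (lamPart w' - lamPart (P.predictor a w w'))) := by
      simp only [Matrix.mulVec_sub]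
      abel
    have e2 : (a.β • ((a.σ₁ + 1) • P.imX e i - ∑ l, P.imX e l))
          - (lamPart w' - lamPart (P.predictor a w w'))
        = (a.β * (a.σ₁ - 1)) • P.imX e i
        + a.β • ((2 : ℝ) • P.imX e i - ∑ l, P.imX e l)
        + ((a.τ + a.s - 1) • lamPart e + (-(a.s * a.β)) • ∑ j, P.imY e j) := by
      rw [hlam]
      module
    rw [← e2, ← e1]
  · refine (sqNorm_sub_projection_le (hym j) (hzy j) (hω' j) (hzy' j)).trans ?_
    refine le_trans (le_of_eq ?_) (sqNorm_transpose_mulVec_le (P.B j) _)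
    congr 1
    rw [yPart_matQ_mulVec, one_smul]
    have e1 : ω j - (P.B j)ᵀ *ᵥ lamPart w'
        - (ω j + -((P.B j)ᵀ *ᵥ lamPart (P.predictor a w w')
          + (P.B j)ᵀ *ᵥ (((a.σ₂ + 1) * a.β) • P.imY e j - a.τ • lamPart e)))
        = (P.B j)ᵀ *ᵥ ((((a.σ₂ + 1) * a.β) • P.imY e j - a.τ • lamPart e)
          - (lamPart w' - lamPart (P.predictor a w w'))) := by
      simp only [Matrix.mulVec_sub]
      abel
    have e2 : (((a.σ₂ + 1) * a.β) • P.imY e j - a.τ • lamPart e)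
          - (lamPart w' - lamPart (P.predictor a w w'))
        = ((a.σ₂ + 1) * a.β) • P.imY e j
        + (a.s - 1) • lamPart e + (-(a.s * a.β)) • ∑ j, P.imY e j := by
      rw [hlam]
      module
    rw [← e2, ← e1]
  · rw [lamPart_ofBlocks, one_smul, ← hres, lamPart_matQ_mulVec]

/-! ### The constants -/

theorem mu_nonneg (i : Fin p) : 0 ≤ P.mu i := lamMax_gram_nonneg _

theorem nu_nonneg (j : Fin q) : 0 ≤ P.nu j := lamMax_gram_nonneg _

theorem thetaBar_le_delta (i : Fin p) : P.thetaBar a i ≤ P.delta a :=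
  (le_ciSup (Set.finite_range (P.thetaBar a)).bddAbove i).trans (le_max_left _ _)

theorem varthetaBar_le_delta (j : Fin q) : P.varthetaBar a j ≤ P.delta a :=
  (le_ciSup (Set.finite_range (P.varthetaBar a)).bddAbove j).trans
    ((le_max_left _ _).trans (le_max_right _ _))

theorem etaBar_le_delta : P.etaBar a ≤ P.delta a :=
  (le_max_right _ _).trans (le_max_right _ _)

theorem delta_mul_mu_le (i : Fin p) : P.delta a * P.mu i ≤ P.deltaMax a :=
  (le_ciSup (Set.finite_range fun i => P.delta a * P.mu i).bddAbove i).trans (le_max_left _ _)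

theorem delta_mul_nu_le (j : Fin q) : P.delta a * P.nu j ≤ P.deltaMax a :=
  (le_ciSup (Set.finite_range fun j => P.delta a * P.nu j).bddAbove j).trans
    ((le_max_left _ _).trans (le_max_right _ _))

theorem delta_le_deltaMax : P.delta a ≤ P.deltaMax a :=
  (le_max_right _ _).trans (le_max_right _ _)

theorem delta_pos (hβ : 0 < a.β) : 0 < P.delta a := by
  refine lt_of_lt_of_le ?_ P.etaBar_le_delta
  have h1 : 0 ≤ ∑ l, P.mu l := Finset.sum_nonneg fun i _ => P.mu_nonneg i
  have h2 : 0 ≤ ∑ l, P.nu l := Finset.sum_nonneg fun j _ => P.nu_nonneg j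
  rw [etaBar]
  positivity

theorem delta_mul_sum_le (hβ : 0 < a.β) (e : WVec n m d) :
    P.delta a * (∑ i, sqNorm (P.imX e i) + ∑ j, sqNorm (P.imY e j) + sqNorm (lamPart e))
      ≤ P.deltaMax a * sqNorm e := by
  have hδ := (P.delta_pos hβ).le
  have h : sqNorm e = ∑ i, sqNorm (xPart e i) + ∑ j, sqNorm (yPart e j) + sqNorm (lamPart e) :=
    dotProduct_wVec e e
  rw [h, mul_add, mul_add, mul_add, mul_add]
  simp only [Finset.mul_sum]
  refine add_le_add (add_le_add (Finset.sum_le_sum fun i _ => ?_)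
    (Finset.sum_le_sum fun j _ => ?_)) (mul_le_mul_of_nonneg_right P.delta_le_deltaMax
      (sqNorm_nonneg _))
  · calc P.delta a * sqNorm (P.imX e i) ≤ P.delta a * (P.mu i * sqNorm (xPart e i)) :=
          mul_le_mul_of_nonneg_left (sqNorm_mulVec_le _ _) hδ
      _ = P.delta a * P.mu i * sqNorm (xPart e i) := by ring
      _ ≤ _ := mul_le_mul_of_nonneg_right (P.delta_mul_mu_le i) (sqNorm_nonneg _)
  · calc P.delta a * sqNorm (P.imY e j) ≤ P.delta a * (P.nu j * sqNorm (yPart e j)) :=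
          mul_le_mul_of_nonneg_left (sqNorm_mulVec_le _ _) hδ
      _ = P.delta a * P.nu j * sqNorm (yPart e j) := by ring
      _ ≤ _ := mul_le_mul_of_nonneg_right (P.delta_mul_nu_le j) (sqNorm_nonneg _)

/-- The coefficients `θᵢ` control the quadratic form in the images `Aᵢ xᵢ` that the residual of the
`x`-blocks produces only up to the factor `(8 + 2p) p`, which does not depend on the parameters of
the method. -/
theorem sum_mu_mul_le (hp : 1 ≤ p) :
    (∑ l, P.mu l) * (4 * (a.β ^ 2 * ((a.σ₁ - 1) ^ 2 + (8 + 2 * p))))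
      ≤ (8 + 2 * p) * p * P.delta a := by
  have hp' : (1 : ℝ) ≤ p := by exact_mod_cast hp
  have h1 : ∑ i, P.thetaBar a i ≤ p * P.delta a := by
    have := Finset.sum_le_sum fun i (_ : i ∈ Finset.univ) => P.thetaBar_le_delta (a := a) i
    simpa using this
  have h2 : ∑ i, P.thetaBar a i
      = p * (4 * p * (1 - a.σ₁) ^ 2 * a.β ^ 2 * ∑ l, P.mu l) + 4 * a.β ^ 2 * ∑ l, P.mu l := by
    simp only [thetaBar, Finset.sum_add_distrib, ← Finset.mul_sum]
    rw [Finset.sum_const, Finset.card_univ, Fintype.card_fin, nsmul_eq_mul]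
    ring
  rw [h2] at h1
  set T := a.β ^ 2 * ∑ l, P.mu l with hT
  have hT0 : 0 ≤ T :=
    mul_nonneg (sq_nonneg _) (Finset.sum_nonneg fun i _ => P.mu_nonneg i)
  have h3 : 0 ≤ T * (a.σ₁ - 1) ^ 2 := mul_nonneg hT0 (sq_nonneg _)
  have h4 := mul_le_mul_of_nonneg_left h1 (by positivity : (0 : ℝ) ≤ 8 + 2 * p)
  have h5 : (1 : ℝ) ≤ (8 + 2 * p) * (p * p) := by nlinarith
  have h6 := mul_le_mul_of_nonneg_right h5 h3
  calc (∑ l, P.mu l) * (4 * (a.β ^ 2 * ((a.σ₁ - 1) ^ 2 + (8 + 2 * p))))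
      = 4 * (1 * (T * (a.σ₁ - 1) ^ 2)) + (8 + 2 * p) * (4 * T) := by rw [hT]; ring
    _ ≤ 4 * ((8 + 2 * p) * (p * p) * (T * (a.σ₁ - 1) ^ 2)) + (8 + 2 * p) * (4 * T) := by linarith
    _ = (8 + 2 * p) * (p * (4 * p * (1 - a.σ₁) ^ 2 * a.β ^ 2 * ∑ l, P.mu l)
          + 4 * a.β ^ 2 * ∑ l, P.mu l) := by rw [hT]; ring
    _ ≤ _ := by linarith

theorem sqNorm_x_residual_le (e : WVec n m d) (i : Fin p) :
    sqNorm ((a.β * (a.σ₁ - 1)) • P.imX e i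
        + a.β • ((2 : ℝ) • P.imX e i - ∑ l, P.imX e l)
        + ((a.τ + a.s - 1) • lamPart e + (-(a.s * a.β)) • ∑ j, P.imY e j))
      ≤ 4 * (a.β ^ 2 * ((a.σ₁ - 1) ^ 2 + (8 + 2 * p))) * ∑ l, sqNorm (P.imX e l)
        + 4 * (a.τ + a.s - 1) ^ 2 * sqNorm (lamPart e)
        + 4 * q * (a.s * a.β) ^ 2 * ∑ j, sqNorm (P.imY e j) := by
  have hi : sqNorm (P.imX e i) ≤ ∑ l, sqNorm (P.imX e l) :=
    Finset.single_le_sum (f := fun l => sqNorm (P.imX e l)) (fun l _ => sqNorm_nonneg _)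
      (Finset.mem_univ i)
  have hA := sqNorm_sum_le (P.imX e)
  have hB := sqNorm_sum_le (P.imY e)
  rw [Fintype.card_fin] at hA hB
  have h1 := sqNorm_add_le ((a.β * (a.σ₁ - 1)) • P.imX e i
    + a.β • ((2 : ℝ) • P.imX e i - ∑ l, P.imX e l))
    ((a.τ + a.s - 1) • lamPart e + (-(a.s * a.β)) • ∑ j, P.imY e j)
  have h2 := sqNorm_add_le ((a.β * (a.σ₁ - 1)) • P.imX e i)
    (a.β • ((2 : ℝ) • P.imX e i - ∑ l, P.imX e l))
  have h3 := sqNorm_add_le ((a.τ + a.s - 1) • lamPart e) ((-(a.s * a.β)) • ∑ j, P.imY e j)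
  have h4 := sqNorm_add_le ((2 : ℝ) • P.imX e i) (-∑ l, P.imX e l)
  rw [← sub_eq_add_neg, sqNorm_neg, sqNorm_smul] at h4
  simp only [sqNorm_smul] at h2 h3
  set SA := ∑ l, sqNorm (P.imX e l)
  set SB := ∑ j, sqNorm (P.imY e j)
  have h5 : sqNorm ((2 : ℝ) • P.imX e i - ∑ l, P.imX e l) ≤ (8 + 2 * p) * SA := by linarith
  have h6 := mul_le_mul_of_nonneg_left h5 (sq_nonneg a.β)
  have h7 := mul_le_mul_of_nonneg_left hi (sq_nonneg (a.β * (a.σ₁ - 1)))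
  have h8 := mul_le_mul_of_nonneg_left hB (sq_nonneg (a.s * a.β))
  rw [neg_sq] at h3
  nlinarith

theorem sqNorm_y_residual_le (e : WVec n m d) (j : Fin q) :
    sqNorm (((a.σ₂ + 1) * a.β) • P.imY e j + (a.s - 1) • lamPart e
        + (-(a.s * a.β)) • ∑ j, P.imY e j)
      ≤ 3 * ((a.σ₂ + 1) ^ 2 * a.β ^ 2) * sqNorm (P.imY e j)
        + 3 * (a.s - 1) ^ 2 * sqNorm (lamPart e)
        + 3 * q * (a.s * a.β) ^ 2 * ∑ j, sqNorm (P.imY e j) := by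
  have hB := sqNorm_sum_le (P.imY e)
  rw [Fintype.card_fin] at hB
  have h1 := sqNorm_sum_le ![((a.σ₂ + 1) * a.β) • P.imY e j, (a.s - 1) • lamPart e,
    (-(a.s * a.β)) • ∑ j, P.imY e j]
  rw [Fintype.card_fin, Fin.sum_univ_three, Fin.sum_univ_three] at h1
  simp only [Matrix.cons_val, sqNorm_smul] at h1
  have h8 := mul_le_mul_of_nonneg_left hB (sq_nonneg (a.s * a.β))
  rw [neg_sq] at h1
  push_cast at h1
  nlinarith

/-- The residual of the new iterate is bounded by the change `e = w^k - w̃` of the iterates, with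
the constant of the convergence rate up to the parameter-free factor `(8 + 2p) p`. -/
theorem IsStep.exists_errMap_le (hp : 1 ≤ p) (hβ : 0 < a.β)
    (hf : ∀ i, ConvexOn ℝ Set.univ (P.f i))
    (hg : ∀ j, ConvexOn ℝ Set.univ (P.g j)) (hX : ∀ i, IsPolyhedron (P.X i))
    (hY : ∀ j, IsPolyhedron (P.Y j)) {w w' : WVec n m d} (hs : P.IsStep a w w') :
    ∃ r ∈ P.errMap w' 1, sqNorm r
      ≤ (8 + 2 * p) * p * (P.deltaMax a * sqNorm (w - P.predictor a w w')) := by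
  obtain ⟨e, he⟩ : ∃ e, w - P.predictor a w w' = e := ⟨_, rfl⟩
  obtain ⟨r, hr, hx, hy, hl⟩ := hs.exists_mem_errMap P hβ.ne' hf hg hX hY he
  rw [he]
  refine ⟨r, hr, ?_⟩
  have hr' : sqNorm r = ∑ i, sqNorm (xPart r i) + ∑ j, sqNorm (yPart r j) + sqNorm (lamPart r) :=
    dotProduct_wVec r r
  have hδ := (P.delta_pos hβ).le
  have hp' : (1 : ℝ) ≤ p := by exact_mod_cast hp
  have hK : (1 : ℝ) ≤ (8 + 2 * p) * p := by nlinarith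
  refine le_trans ?_ (mul_le_mul_of_nonneg_left (P.delta_mul_sum_le hβ e) (by linarith))
  set SA := ∑ l, sqNorm (P.imX e l)
  set SB := ∑ j, sqNorm (P.imY e j) with hSB
  set L := sqNorm (lamPart e)
  have hSA0 : 0 ≤ SA := Finset.sum_nonneg fun _ _ => sqNorm_nonneg _
  have hSB0 : 0 ≤ SB := Finset.sum_nonneg fun _ _ => sqNorm_nonneg _
  have hL0 : 0 ≤ L := sqNorm_nonneg _
  set μ := ∑ l, P.mu l with hμ
  set ν := ∑ l, P.nu l with hν
  have h1 : ∑ i, sqNorm (xPart r i)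
      ≤ μ * (4 * (a.β ^ 2 * ((a.σ₁ - 1) ^ 2 + (8 + 2 * p))) * SA
        + 4 * (a.τ + a.s - 1) ^ 2 * L + 4 * q * (a.s * a.β) ^ 2 * SB) := by
    rw [hμ, Finset.sum_mul]
    exact Finset.sum_le_sum fun i _ => (hx i).trans
      (mul_le_mul_of_nonneg_left (P.sqNorm_x_residual_le e i) (P.mu_nonneg i))
  have h2 : ∑ j, sqNorm (yPart r j)
      ≤ ∑ j, 3 * (a.σ₂ + 1) ^ 2 * a.β ^ 2 * P.nu j * sqNorm (P.imY e j)
        + ν * (3 * (a.s - 1) ^ 2 * L + 3 * q * (a.s * a.β) ^ 2 * SB) := by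
    rw [hν, Finset.sum_mul, ← Finset.sum_add_distrib]
    refine Finset.sum_le_sum fun j _ => (hy j).trans
      ((mul_le_mul_of_nonneg_left (P.sqNorm_y_residual_le e j) (P.nu_nonneg j)).trans_eq ?_)
    ring
  have h3 : sqNorm (lamPart r) ≤ 2 / a.β ^ 2 * L + 2 * q * SB := by
    have hB := sqNorm_sum_le (P.imY e)
    rw [Fintype.card_fin] at hB
    have h := sqNorm_add_le ((1 / a.β) • lamPart e) (-∑ j, P.imY e j)
    rw [← sub_eq_add_neg, sqNorm_neg, sqNorm_smul, ← hl] at h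
    have e1 : 2 * ((1 / a.β) ^ 2 * sqNorm (lamPart e)) = 2 / a.β ^ 2 * L := by
      rw [one_div, inv_pow]
      ring
    linarith
  have hcA : μ * (4 * (a.β ^ 2 * ((a.σ₁ - 1) ^ 2 + (8 + 2 * p)))) * SA
      ≤ (8 + 2 * p) * p * P.delta a * SA :=
    mul_le_mul_of_nonneg_right (P.sum_mu_mul_le hp) hSA0
  have hcB : (4 * q * (a.s * a.β) ^ 2 * μ + 3 * q * (a.s * a.β) ^ 2 * ν + 2 * q) * SB
      + ∑ j, 3 * (a.σ₂ + 1) ^ 2 * a.β ^ 2 * P.nu j * sqNorm (P.imY e j) ≤ P.delta a * SB := by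
    rw [hSB, Finset.mul_sum _ fun j => sqNorm (P.imY e j),
      Finset.mul_sum _ fun j => sqNorm (P.imY e j), ← Finset.sum_add_distrib]
    refine Finset.sum_le_sum fun j _ => ?_
    refine le_trans (le_of_eq ?_) (mul_le_mul_of_nonneg_right (P.varthetaBar_le_delta (a := a) j)
      (sqNorm_nonneg _))
    rw [varthetaBar]
    ring
  have hcL : (4 * (a.τ + a.s - 1) ^ 2 * μ + 3 * (a.s - 1) ^ 2 * ν + 2 / a.β ^ 2) * L
      ≤ P.delta a * L := mul_le_mul_of_nonneg_right P.etaBar_le_delta hL0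
  have hB' : P.delta a * SB ≤ (8 + 2 * p) * p * (P.delta a * SB) :=
    le_mul_of_one_le_left (mul_nonneg hδ hSB0) hK
  have hL' : P.delta a * L ≤ (8 + 2 * p) * p * (P.delta a * L) :=
    le_mul_of_one_le_left (mul_nonneg hδ hL0) hK
  rw [hr']
  linarith

/-! ### Linear convergence -/

theorem eps_pos [Nonempty (WIdx n m d)] (ha : a.Admissible p q) (hA : ∀ i, (P.A i).rank = m i)
    (hB : ∀ j, (P.B j).rank = d j) {ζ : ℝ} (hζ : 0 < ζ) : 0 < P.eps a ζ := by
  have h1 := lamMin_pos (P.matG_posDef ha hA hB)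
  have h2 := lamMax_pos (P.matH_posDef ha hA hB)
  have h3 := (P.delta_pos ha.1).trans_le P.delta_le_deltaMax
  rw [eps]
  positivity

/-- One iteration reduces the squared `H`-distance to the solution set by the factor
`1 / (1 + ε)`, where `C` is a constant of the error bound at the new iterate. -/
theorem IsStep.distSq_le [Nonempty (WIdx n m d)] (hp : 1 ≤ p) (ha : a.Admissible p q)
    (hA : ∀ i, (P.A i).rank = m i) (hB : ∀ j, (P.B j).rank = d j)
    (hf : ∀ i, ConvexOn ℝ Set.univ (P.f i)) (hg : ∀ j, ConvexOn ℝ Set.univ (P.g j))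
    (hX : ∀ i, IsPolyhedron (P.X i)) (hY : ∀ j, IsPolyhedron (P.Y j))
    (hne : P.solSet.Nonempty) {w w' : WVec n m d} (hs : P.IsStep a w w') {C ζ : ℝ} (hC : 0 ≤ C)
    (hζ : 0 < ζ) (hCζ : C * ((8 + 2 * p) * p) ≤ ζ ^ 2)
    (herr : ∀ e ∈ P.errMap w' 1, distSq 1 w' P.solSet ≤ C * sqNorm e) :
    distSq (P.matH a) w' P.solSet
      ≤ 1 / (1 + P.eps a ζ) * distSq (P.matH a) w P.solSet := by
  have hGd := P.matG_posDef ha hA hB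
  have hHd := P.matH_posDef ha hA hB
  have hG := lamMin_pos hGd
  have hH := lamMax_pos hHd
  have hD := (P.delta_pos ha.1).trans_le P.delta_le_deltaMax
  have hε := P.eps_pos ha hA hB hζ
  set e := w - P.predictor a w w'
  set D := distSq (P.matH a) w' P.solSet
  -- `ε · dist_H²(w', ℳ*) ≤ ‖w - w̃‖_G²`, from the error bound and the residual estimate
  have h1 : P.eps a ζ * D ≤ sqNormW (P.matG a) e := by
    obtain ⟨r, hr, hrn⟩ := hs.exists_errMap_le P hp ha.1 hf hg hX hY
    have h2 := distSq_le_lamMax_mul hHd hH hne w'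
    have h3 := herr r hr
    have hDe : 0 ≤ P.deltaMax a * sqNorm e := mul_nonneg hD.le (sqNorm_nonneg _)
    have h4 : distSq 1 w' P.solSet ≤ ζ ^ 2 * (P.deltaMax a * sqNorm e) :=
      calc distSq 1 w' P.solSet ≤ C * ((8 + 2 * p) * p * (P.deltaMax a * sqNorm e)) :=
            h3.trans (mul_le_mul_of_nonneg_left hrn hC)
        _ = C * ((8 + 2 * p) * p) * (P.deltaMax a * sqNorm e) := by ring
        _ ≤ _ := mul_le_mul_of_nonneg_right hCζ hDe
    have h5 : D ≤ (ζ ^ 2 * P.deltaMax a * lamMax (P.matH a)) * sqNorm e :=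
      calc D ≤ lamMax (P.matH a) * (ζ ^ 2 * (P.deltaMax a * sqNorm e)) :=
            h2.trans (mul_le_mul_of_nonneg_left h4 hH.le)
        _ = _ := by ring
    refine le_trans ?_ (lamMin_mul_sqNorm_le hGd.isHermitian e)
    rw [eps, div_mul_eq_mul_div, div_le_iff₀ (by positivity)]
    calc lamMin (P.matG a) * D
        ≤ lamMin (P.matG a) * ((ζ ^ 2 * P.deltaMax a * lamMax (P.matH a)) * sqNorm e) :=
          mul_le_mul_of_nonneg_left h5 hG.le
      _ = _ := by ring
  have h2 : D + sqNormW (P.matG a) e ≤ distSq (P.matH a) w P.solSet := by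
    refine le_distSq hne fun v hv => ?_
    have h3 := hs.contraction P ha hf hg (fun i => (hX i).convex) (fun j => (hY j).convex) hv
    have h4 : D ≤ sqNormW (P.matH a) (w' - v) := GSADMM.distSq_le hHd.posSemidef hv w'
    linarith
  rw [one_div, ← div_eq_inv_mul, le_div_iff₀ (by linarith)]
  linarith

end Problem

end GSADMM

theorem theorem5 {n p q : ℕ} (hp : 1 ≤ p) (hq : 1 ≤ q)
    {m : Fin p → ℕ} {d : Fin q → ℕ} (hm : ∀ i, 1 ≤ m i) (hd : ∀ j, 1 ≤ d j)
    (P : GSADMM.Problem n m d)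
    (hA : ∀ i, (P.A i).rank = m i) (hB : ∀ j, (P.B j).rank = d j)
    (hf : ∀ i, ConvexOn ℝ Set.univ (P.f i)) (hg : ∀ j, ConvexOn ℝ Set.univ (P.g j))
    (hX : ∀ i, GSADMM.IsPolyhedron (P.X i)) (hY : ∀ j, GSADMM.IsPolyhedron (P.Y j))
    (hfs : ∀ i, GSADMM.IsPiecewiseLinear (GSADMM.subdiff (P.f i)))
    (hgs : ∀ j, GSADMM.IsPiecewiseLinear (GSADMM.subdiff (P.g j)))
    (hsol : ∃ x y, P.IsSolution x y) :
    P.solSet.Nonempty ∧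
    ∀ R : ℝ, 0 < R → ∃ ζ : ℝ, 0 < ζ ∧
      (∀ v ∈ P.feasW, GSADMM.distSq 1 v P.solSet ≤ R ^ 2 →
        GSADMM.distSq 1 v P.solSet ≤ ζ ^ 2 * GSADMM.distSq 1 0 (P.errMap v 1)) ∧
      ∀ a : GSADMM.Params, a.Admissible p q →
        0 < P.eps a ζ ∧
        ∀ w : ℕ → GSADMM.WVec n m d, P.IsGSADMM a w →
          GSADMM.distSq (P.matH a) (w 0) P.solSet ≤ GSADMM.lamMin (P.matH a) * R ^ 2 →
          ∀ k, GSADMM.distSq (P.matH a) (w (k + 1)) P.solSet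
            ≤ 1 / (1 + P.eps a ζ) * GSADMM.distSq (P.matH a) (w k) P.solSet := by
  have hne : P.solSet.Nonempty := P.solSet_nonempty hf hg hX hY hsol
  refine ⟨hne, fun R hR => ?_⟩
  obtain ⟨C, hC, herr⟩ := P.exists_error_bound hX hY hfs hgs hR
  have hp' : (1 : ℝ) ≤ p := by exact_mod_cast hp
  have hK : (1 : ℝ) ≤ (8 + 2 * p) * p := by nlinarith
  have hCK : 0 < C * ((8 + 2 * p) * p) := by positivity
  have hle : C ≤ C * ((8 + 2 * p) * p) := le_mul_of_one_le_right hC.le hK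
  -- `C` is the constant of the error bound; the second factor, independent of the parameters of the
  -- method, absorbs what the coefficients `θᵢ` miss
  refine ⟨Real.sqrt (C * ((8 + 2 * p) * p)), Real.sqrt_pos.2 hCK, fun v hv hvR => ?_,
    fun a ha => ?_⟩
  · rw [Real.sq_sqrt hCK.le, ← div_le_iff₀' hCK]
    refine GSADMM.le_distSq (P.errMap_nonempty hf hg hX hY ⟨v, hv⟩ v) fun e he => ?_
    rw [div_le_iff₀' hCK, GSADMM.sqNormW_one, zero_sub, GSADMM.sqNorm_neg]
    exact (herr v hvR e he).trans (mul_le_mul_of_nonneg_right hle (GSADMM.sqNorm_nonneg e))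
  · have : Nonempty (GSADMM.WIdx n m d) := ⟨Sum.inl ⟨⟨0, hp⟩, ⟨0, hm _⟩⟩⟩
    have hHd := P.matH_posDef ha hA hB
    have hH := GSADMM.lamMin_pos hHd
    refine ⟨P.eps_pos ha hA hB (Real.sqrt_pos.2 hCK), fun w hw h0 k => ?_⟩
    -- the `H`-distances decrease, so all iterates stay where the error bound holds
    have hmono : ∀ l, GSADMM.distSq (P.matH a) (w (l + 1)) P.solSet
        ≤ GSADMM.distSq (P.matH a) (w l) P.solSet := fun l =>
      GSADMM.le_distSq hne fun v hv => by
        have h1 := (hw l).contraction P ha hf hg (fun i => (hX i).convex)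
          (fun j => (hY j).convex) hv
        have h2 := GSADMM.sqNormW_nonneg (P.matG_posDef ha hA hB).posSemidef
          (w l - P.predictor a (w l) (w (l + 1)))
        have h3 := GSADMM.distSq_le hHd.posSemidef hv (w (l + 1))
        linarith
    have hall := antitone_nat_of_succ_le
      (f := fun l => GSADMM.distSq (P.matH a) (w l) P.solSet) hmono (Nat.zero_le (k + 1))
    have hR' : GSADMM.distSq 1 (w (k + 1)) P.solSet ≤ R ^ 2 :=
      le_of_mul_le_mul_left
        ((GSADMM.lamMin_mul_distSq_le hHd hH.le hne _).trans (hall.trans h0)) hH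
    exact (hw k).distSq_le P hp ha hA hB hf hg hX hY hne hC.le (Real.sqrt_pos.2 hCK)
      (Real.sq_sqrt hCK.le).ge (herr _ hR')
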